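/- A dataset consists of a matrix $X \in \mathbb{R}^{m \times n}$ ($m$ data objects, $n$ features) and a target $y \in \{0,1\}^m$. A subgroup is described by bounds $lb, ub \in (\mathbb{R} \cup \{-\infty,+\infty\})^n$; data object $i$ is a member of it if $lb_j \le X_{ij} \le ub_j$ for all $j$. Feature $j$ is selected if $X_{ij} < lb_j$ or $X_{ij} > ub_j$ for some $i$. The feature-cardinality constraint with threshold $k \in \mathbb{N}$ requires that at most $k$ features are selected. Subgroup discovery with a feature-cardinality constraint asks, given $(X, y, k)$, for bounds that maximize a fixed quality function $Q(lb, ub, X, y) \in \mathbb{R}$ among all bounds in $(\mathbb{R} \cup \{-\infty,+\infty\})^n$ that satisfy the constraint. Its decision version asks, given in addition a number $\theta$, whether some bounds that satisfy the constraint have $Q(lb, ub, X, y) \ge \theta$. Real numbers are given to algorithms as bit strings through a notation $\nu : \{0,1\}^* \to \mathbb{R}$ whose order relation $\nu(w) \le \nu(w')$ is decidable in polynomial time (for instance, fractions of binary integers). Assume that (i) $Q(lb, ub, X, y)$ depends on $(lb, ub)$ only through the truth values of the conditions $lb_j \le X_{ij}$ and $X_{ij} \le ub_j$ (which holds, for example,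 if it depends on the bounds through subgroup membership only), and (ii) $Q$ can be evaluated in polynomial time: some polynomial-time Turing machine, given an encoded dataset and encoded bounds, outputs a name of $Q(lb, ub, X, y)$. Then subgroup discovery with a feature-cardinality constraint, and also its decision version, lies in $\mathcal{XP}$ for the parameter $k$: there are a Turing machine and computable functions $f, g : \mathbb{N} \to \mathbb{N}$ such that the machine, on every encoded instance $x$ with threshold $k$, halts after at most $f(k) \cdot |x|^{g(k)}$ steps and outputs optimal bounds (for the decision version: the correct answer). -/

import Mathlib

namespace SubgroupDiscovery

open Computability Turing

/-! ### Subgroups, quality, feature-cardinality constraint (over the reals) -/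

/-- Data object `i` of `X` is a member of the subgroup with bounds `lb`, `ub`. -/
def Member {m n : ℕ} (X : Matrix (Fin m) (Fin n) ℝ) (lb ub : Fin n → EReal) (i : Fin m) : Prop :=
  ∀ j, lb j ≤ (X i j : EReal) ∧ (X i j : EReal) ≤ ub j

/-- Feature `j` is selected: its bounds exclude at least one data object of `X`. -/
def Selected {m n : ℕ} (X : Matrix (Fin m) (Fin n) ℝ) (lb ub : Fin n → EReal) (j : Fin n) : Prop :=
  ∃ i, (X i j : EReal) < lb j ∨ ub j < (X i j : EReal)

/-- Feature-cardinality constraint: at most `k` features are selected. -/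
def CardinalityConstraint {m n : ℕ} (X : Matrix (Fin m) (Fin n) ℝ) (k : ℕ)
    (lb ub : Fin n → EReal) : Prop :=
  {j | Selected X lb ub j}.ncard ≤ k

/-- A notion of subgroup quality `Q(lb, ub, X, y)`, for datasets of every size; the label `true`
is the class `1`. -/
abbrev Quality : Type :=
  ∀ {m n : ℕ}, (Fin n → EReal) → (Fin n → EReal) → Matrix (Fin m) (Fin n) ℝ → (Fin m → Bool) → ℝ

/-- Quality sees the bounds only through the data: if two choices of bounds induce the
same truth values of all the conditions `lb j ≤ X i j` and `X i j ≤ ub j`, then they have the same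
quality. In particular, this holds for every quality that depends on the bounds through
subgroup membership only. -/
def Quality.DataDetermined (Q : Quality) : Prop :=
  ∀ (m n : ℕ) (X : Matrix (Fin m) (Fin n) ℝ) (y : Fin m → Bool) (lb ub lb' ub' : Fin n → EReal),
    (∀ i j, (lb j ≤ (X i j : EReal) ↔ lb' j ≤ (X i j : EReal)) ∧
      ((X i j : EReal) ≤ ub j ↔ (X i j : EReal) ≤ ub' j)) →
    Q lb ub X y = Q lb' ub' X y

/-- `(lb, ub)` solves subgroup discovery with feature-cardinality threshold `k` on `(X, y)`:
it satisfies the constraint and has maximal quality among all bounds in `ℝ ∪ {±∞}` that do. -/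
def IsOptimalSubgroup (Q : Quality) {m n : ℕ} (X : Matrix (Fin m) (Fin n) ℝ) (y : Fin m → Bool)
    (k : ℕ) (lb ub : Fin n → EReal) : Prop :=
  CardinalityConstraint X k lb ub ∧
    ∀ lb' ub' : Fin n → EReal, CardinalityConstraint X k lb' ub' → Q lb' ub' X y ≤ Q lb ub X y

/-! ### Encoding of instances as strings

Real numbers are given to a machine as bit strings, read through a notation `ν : List Bool → ℝ`. -/

/-- The finite alphabet for instances and subgroup descriptions. -/
inductive Sym : Type
  | bit (b : Bool)
  | tick
  | sep
  | negInf
  | posInf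

/-- A named bound: `-∞`, `+∞`, or the name of a real number. -/
inductive Bound : Type
  | negInf
  | posInf
  | num (w : List Bool)

/-- The value in `ℝ ∪ {±∞}` of a named bound. -/
noncomputable def Bound.val (ν : List Bool → ℝ) : Bound → EReal
  | .negInf => ⊥
  | .posInf => ⊤
  | .num w => (ν w : EReal)

/-- A dataset with `m` data objects and `n` features, whose entries are names of real numbers. -/
structure Dataset where
  m : ℕ
  n : ℕ
  X : Matrix (Fin m) (Fin n) (List Bool)
  y : Fin m → Bool

/-- The real matrix named by a dataset. -/
def Dataset.realX (D : Dataset) (ν : List Bool → ℝ) : Matrix (Fin D.m) (Fin D.n) ℝ :=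
  D.X.map ν

/-- A named subgroup description for `n` features. -/
structure Desc (n : ℕ) where
  lb : Fin n → Bound
  ub : Fin n → Bound

/-- The lower bounds named by a description. -/
noncomputable def Desc.lbVal {n : ℕ} (s : Desc n) (ν : List Bool → ℝ) (j : Fin n) : EReal :=
  (s.lb j).val ν

/-- The upper bounds named by a description. -/
noncomputable def Desc.ubVal {n : ℕ} (s : Desc n) (ν : List Bool → ℝ) (j : Fin n) : EReal :=
  (s.ub j).val ν

def encWord (w : List Bool) : List Sym :=
  w.map Sym.bit ++ [Sym.sep]

/-- Natural numbers are written in unary. -/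
def encNat (k : ℕ) : List Sym :=
  List.replicate k Sym.tick ++ [Sym.sep]

def encWords (p : List Bool × List Bool) : List Sym :=
  encWord p.1 ++ encWord p.2

def encBound : Bound → List Sym
  | .negInf => [Sym.negInf, Sym.sep]
  | .posInf => [Sym.posInf, Sym.sep]
  | .num w => encWord w

def encDesc {n : ℕ} (s : Desc n) : List Sym :=
  (List.finRange n).flatMap fun j => encBound (s.lb j) ++ encBound (s.ub j)

/-- The number of features, then the data objects one by one (a tick, the label, and the entries),
then an end mark. -/
def encDataset (D : Dataset) : List Sym :=
  encNat D.n ++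
    ((List.finRange D.m).flatMap fun i =>
      Sym.tick :: Sym.bit (D.y i) :: (List.finRange D.n).flatMap fun j => encWord (D.X i j)) ++
    [Sym.sep]

/-- A dataset together with a description of a subgroup. -/
def encDatasetDesc (p : (D : Dataset) × Desc D.n) : List Sym :=
  encDataset p.1 ++ encDesc p.2

/-- Instance of the search problem: a dataset and the threshold `k`. -/
def encSearch (x : Dataset × ℕ) : List Sym :=
  encNat x.2 ++ encDataset x.1

/-- Instance of the decision problem: a dataset, the threshold `k`, and a name of a
quality threshold. -/
def encDecision (x : Dataset × ℕ × List Bool) : List Sym :=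
  encNat x.2.1 ++ encDataset x.1 ++ encWord x.2.2

/-! ### Complexity (multi-stack Turing machines) -/

/-- `f` is computed by a Turing machine in polynomial time. -/
def PolyTimeComputable {α β αΓ βΓ : Type} (ea : α → List αΓ) (eb : β → List βΓ) (f : α → β) :
    Prop :=
  Nonempty (TM2ComputableInPolyTime ea eb f)

/-- `P` is decided by a Turing machine in polynomial time. -/
def PolyTimeDecidable {α αΓ : Type} (ea : α → List αΓ) (P : α → Prop) : Prop :=
  ∃ f : α → Bool, (∀ a, f a = true ↔ P a) ∧ PolyTimeComputable ea encodeBool f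

/-- The search problem "given `x`, find some `o` with `R x o`" is in XP for the parameter `κ`:
there are one Turing machine and computable `f`, `g` such that the machine, on every instance `x`,
halts within `f (κ x) * |x| ^ g (κ x)` steps, with a solution of `x` as its output. -/
def SearchInXP {α αΓ βΓ : Type} {β : α → Type} (ea : α → List αΓ) (eb : ∀ x, β x → List βΓ)
    (κ : α → ℕ) (R : ∀ x, β x → Prop) : Prop :=
  ∃ (M : TM2ComputableAux αΓ βΓ) (f g : ℕ → ℕ), Computable f ∧ Computable g ∧
    ∀ x, ∃ o : β x, R x o ∧
      Nonempty (TM2OutputsInTime M.tm ((ea x).map M.inputAlphabet.invFun)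
        (some ((eb x o).map M.outputAlphabet.invFun))
        (f (κ x) * (ea x).length ^ g (κ x)))

/-- The decision problem `P` is in the class XP for the parameter `κ`. -/
def DecisionInXP {α αΓ : Type} (ea : α → List αΓ) (κ : α → ℕ) (P : α → Prop) : Prop :=
  SearchInXP (β := fun _ => Bool) ea (fun _ => encodeBool) κ fun x b => (b = true ↔ P x)

end SubgroupDiscovery

/-! Quality sees a bound only through its comparisons with the data. A lower bound of feature j may
therefore be replaced by the least value of column j that is not below it, or by +∞ if there is
none, and dually for upper bounds. A feature that is not selected passes all its comparisons and may
be given the range (-∞, +∞). So finitely many candidates suffice: at most k features carry a range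
with end points among the data values and ±∞, all others the full range (`exists_leaf`). Conversely,
a feature with the full range is never selected, so every candidate satisfies the constraint
(`cardinalityConstraint_descOf`). A best candidate is then optimal among all bounds
(`isOptimalSubgroup_bestDesc`), and comparing its quality with the threshold answers the decision
problem.

The candidates are the leaves of a tree that fixes one feature per level and spends one unit of
budget on each range taken from a list of length G. With r levels and budget b the tree has at most
(r + 1) * (1 + r * G) ^ b nodes (`nodeCount_le`). Since n and G are polynomial in the instance
length and each node costs polynomial time, k enters only the exponent, and the total time is at
most |x| ^ (a + b * k) for constants a and b (`exists_searchTime_bound`).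

The remaining work is to realize this search on a Turing machine. It is written in a small language
of stack commands with procedure calls, whose semantics `Cmd.Runs` carries a time bound.
`Cmd.Runs.reachesIn` compiles such programs to one multi-stack machine that contains the given
machines for quality and comparison as subroutines. `runs_searchLoop` follows the traversal of the
tree, and `exists_fits` bounds all words and subroutine times polynomially; the names of qualities
are short because a machine cannot write more than its running time permits
(`exists_output_length_le`). -/

namespace SubgroupDiscovery

open Computability Turing Function

/-! ### Structured programs over stacks -/

/-- Programs that act on stacks `R` over the alphabet `A` and may call procedures `ι`. -/
inductive Cmd (R A ι : Type) : Type
  | skip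
  | push (r : R) (a : A)
  | pop (r : R) (next : Option A → Cmd R A ι)
  | seq (c d : Cmd R A ι)
  | loop (r : R) (p : Option A → Bool) (body : Cmd R A ι)
  | call (i : ι) (src dst : R)

namespace Cmd

variable {R A ι : Type} [DecidableEq R]

/-- `Runs O c S S' t`: the program `c` leads from the stacks `S` to the stacks `S'` within `t`
steps, where `O i l o u` says that procedure `i` turns `l` into `o` within `u` steps. -/
inductive Runs (O : ι → List A → List A → ℕ → Prop) :
    Cmd R A ι → (R → List A) → (R → List A) → ℕ → Prop
  | skip (S) : Runs O .skip S S 1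
  | push (r a S) : Runs O (.push r a) S (update S r (a :: S r)) 1
  | pop {r next S S' t} (h : Runs O (next (S r).head?) (update S r (S r).tail) S' t) :
      Runs O (.pop r next) S S' (t + 1)
  | seq {c d S S' S'' t u} (h : Runs O c S S' t) (h' : Runs O d S' S'' u) :
      Runs O (.seq c d) S S'' (t + u)
  | loop_exit {r p body S} (h : p (S r).head? = false) : Runs O (.loop r p body) S S 1
  | loop_step {r p body S S' S'' t u} (h : p (S r).head? = true) (hb : Runs O body S S' t)
      (hl : Runs O (.loop r p body) S' S'' u) : Runs O (.loop r p body) S S'' (t + u + 1)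
  | call {i src dst S out t} (h : O i (S src).reverse out t) :
      Runs O (.call i src dst) S
        (update (update S src []) dst (out.reverse ++ update S src [] dst))
        ((S src).length + t + out.length + 2)
  | mono {c S S' t u} (h : Runs O c S S' t) (htu : t ≤ u) : Runs O c S S' u

/-! ### Reachability within a number of steps -/

/-- `f` leads from `a` to `b` in at most `n` steps. -/
def ReachesIn {X : Type} (f : X → Option X) (n : ℕ) (a b : X) : Prop :=
  ∃ m ≤ n, (flip bind f)^[m] (some a) = some b

theorem ReachesIn.refl {X : Type} (f : X → Option X) (n : ℕ) (a : X) : ReachesIn f n a a :=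
  ⟨0, n.zero_le, rfl⟩

theorem ReachesIn.mono {X : Type} {f : X → Option X} {n n' : ℕ} {a b : X}
    (h : ReachesIn f n a b) (hn : n ≤ n') : ReachesIn f n' a b :=
  let ⟨m, hm, e⟩ := h
  ⟨m, hm.trans hn, e⟩

theorem ReachesIn.trans {X : Type} {f : X → Option X} {n n' : ℕ} {a b c : X}
    (h : ReachesIn f n a b) (h' : ReachesIn f n' b c) : ReachesIn f (n + n') a c := by
  obtain ⟨m, hm, e⟩ := h
  obtain ⟨m', hm', e'⟩ := h'
  exact ⟨m' + m, by omega, by rw [iterate_add_apply, e, e']⟩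

theorem ReachesIn.single {X : Type} {f : X → Option X} {a b : X} (h : f a = some b) :
    ReachesIn f 1 a b :=
  ⟨1, le_rfl, h⟩

theorem iterate_bind_none {X : Type} (f : X → Option X) (n : ℕ) :
    (flip bind f)^[n] none = none := by
  induction n with
  | zero => rfl
  | succ n ih => rw [iterate_succ_apply]; exact ih

/-! ### Compilation to a multi-stack machine -/

section Compile

variable (M : ι → FinTM2) (B : Type)

/-- The stacks of the compiled machine: registers, an output stack, and the stacks of the
procedures. -/
abbrev StackIdx (R : Type) (M : ι → FinTM2) : Type := R ⊕ Unit ⊕ (Σ i, (M i).K)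

/-- The alphabets of the stacks of the compiled machine. -/
abbrev StackSym (R A B : Type) (M : ι → FinTM2) : StackIdx R M → Type
  | .inl _ => A
  | .inr (.inl _) => B
  | .inr (.inr ⟨i, k⟩) => (M i).Γ k

/-- The internal states of the compiled machine. -/
abbrev Mem (A : Type) (M : ι → FinTM2) : Type := Option A × ∀ i, (M i).σ

/-- The stack contents of the compiled machine. -/
def stk {B : Type} {M : ι → FinTM2} (S : R → List A) (T : List B)
    (W : ∀ i, ∀ k, List ((M i).Γ k)) : ∀ k, List (StackSym R A B M k)
  | .inl r => S r
  | .inr (.inl _) => T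
  | .inr (.inr ⟨i, k⟩) => W i k

variable {M B} [DecidableEq ι]

theorem update_stk_reg (S : R → List A) (T : List B) (W : ∀ i, ∀ k, List ((M i).Γ k)) (r : R)
    (l : List A) :
    update (stk S T W) (.inl r) l = stk (update S r l) T W := by
  funext k
  rcases k with r' | _ | ⟨i, k⟩
  · by_cases h : r' = r
    · subst h; simp [stk]
    · simp [stk, h]
  · simp [stk]
  · simp [stk]

theorem update_stk_out (S : R → List A) (T : List B) (W : ∀ i, ∀ k, List ((M i).Γ k))
    (l : List B) :
    update (stk S T W) (.inr (.inl ())) l = stk S l W := by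
  funext k
  rcases k with r' | _ | ⟨i, k⟩ <;> simp [stk]

theorem update_stk_proc (S : R → List A) (T : List B) (W : ∀ i, ∀ k, List ((M i).Γ k)) (i : ι)
    (k : (M i).K) (l : List ((M i).Γ k)) :
    update (stk S T W) (.inr (.inr ⟨i, k⟩)) l =
      stk S T (update W i (update (W i) k l)) := by
  funext k'
  rcases k' with r' | _ | ⟨j, k'⟩
  · simp [stk]
  · simp [stk]
  · by_cases h : j = i
    · subst h
      by_cases h' : k' = k
      · subst h'; simp [stk]
      · simp [stk, h']
    · simp [stk, h]

/-- A statement of procedure `i` as a statement of the compiled machine. -/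
def liftStmt {Λ : Type} (i : ι) (lab : (M i).Λ → Λ) (exit : Λ) :
    TM2.Stmt (M i).Γ (M i).Λ (M i).σ → TM2.Stmt (StackSym R A B M) Λ (Mem A M)
  | .push k f q => .push (.inr (.inr ⟨i, k⟩)) (fun v => f (v.2 i)) (liftStmt i lab exit q)
  | .peek k f q => .peek (.inr (.inr ⟨i, k⟩))
      (fun v s => (v.1, update v.2 i (f (v.2 i) s))) (liftStmt i lab exit q)
  | .pop k f q => .pop (.inr (.inr ⟨i, k⟩))
      (fun v s => (v.1, update v.2 i (f (v.2 i) s))) (liftStmt i lab exit q)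
  | .load f q => .load (fun v => (v.1, update v.2 i (f (v.2 i)))) (liftStmt i lab exit q)
  | .branch f q₁ q₂ =>
      .branch (fun v => f (v.2 i)) (liftStmt i lab exit q₁) (liftStmt i lab exit q₂)
  | .goto f => .goto fun v => lab (f (v.2 i))
  | .halt => .goto fun _ => exit

/-- The lifted statement touches only component `i` of the memory and the stacks of procedure `i`;
halting turns into a jump to `exit`. Writing both as `update` at `i` keeps the form stable under the
induction on the statement. -/
theorem stepAux_liftStmt {Λ : Type} (i : ι) (lab : (M i).Λ → Λ) (exit : Λ)
    (q : TM2.Stmt (M i).Γ (M i).Λ (M i).σ) (o : Option A) (I : ∀ i, (M i).σ) (v : (M i).σ)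
    (S : R → List A) (T : List B) (W : ∀ i, ∀ k, List ((M i).Γ k))
    (U : ∀ k, List ((M i).Γ k)) :
    TM2.stepAux (liftStmt i lab exit q) (o, update I i v) (stk S T (update W i U)) =
      ⟨some ((TM2.stepAux q v U).l.elim exit lab), (o, update I i (TM2.stepAux q v U).var),
        stk S T (update W i (TM2.stepAux q v U).stk)⟩ := by
  induction q generalizing v U with
  | push k f q ih =>
    simp only [liftStmt, TM2.stepAux, update_stk_proc, update_self, update_idem]
    rw [← ih]; simp [stk]
  | peek k f q ih =>
    simp only [liftStmt, TM2.stepAux, update_self, update_idem]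
    rw [← ih]; simp [stk]
  | pop k f q ih =>
    simp only [liftStmt, TM2.stepAux, update_stk_proc, update_self, update_idem]
    rw [← ih]; simp [stk]
  | load f q ih =>
    simp only [liftStmt, TM2.stepAux, update_self, update_idem]
    rw [← ih]
  | branch f q₁ q₂ ih₁ ih₂ =>
    simp only [liftStmt, TM2.stepAux, update_self]
    cases f v <;> simp [ih₁, ih₂]
  | goto f => simp [liftStmt]
  | halt => simp [liftStmt]

/-- The labels of a compiled program. -/
def Lab (M : ι → FinTM2) : Cmd R A ι → Type
  | .skip => Unit
  | .push _ _ => Unit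
  | .pop _ next => Option (Σ a, Lab M (next a))
  | .seq c d => Lab M c ⊕ Lab M d
  | .loop _ _ body => Option (Lab M body)
  | .call i _ _ => (M i).Λ ⊕ Bool

/-- A compiled program has finitely many labels. -/
@[reducible]
noncomputable def fintypeLab [Fintype A] (M : ι → FinTM2) : ∀ c : Cmd R A ι, Fintype (Lab M c)
  | .skip => inferInstanceAs (Fintype Unit)
  | .push _ _ => inferInstanceAs (Fintype Unit)
  | .pop _ next =>
    haveI := fun a => fintypeLab M (next a)
    inferInstanceAs (Fintype (Option (Σ a, Lab M (next a))))
  | .seq c d =>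
    haveI := fintypeLab M c
    haveI := fintypeLab M d
    inferInstanceAs (Fintype (Lab M c ⊕ Lab M d))
  | .loop _ _ body =>
    haveI := fintypeLab M body
    inferInstanceAs (Fintype (Option (Lab M body)))
  | .call i _ _ =>
    haveI := (M i).ΛFin
    inferInstanceAs (Fintype ((M i).Λ ⊕ Bool))

/-- The label at which a compiled program starts. -/
def entry (M : ι → FinTM2) : ∀ c : Cmd R A ι, Lab M c
  | .skip => ()
  | .push _ _ => ()
  | .pop _ _ => none
  | .seq c _ => .inl (entry M c)
  | .loop _ _ _ => none
  | .call _ _ _ => .inr false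

theorem initList_stk_eq (N : FinTM2) (l : List (N.Γ N.k₀)) :
    (initList N l).stk = update (fun _ => []) N.k₀ l := by
  funext k
  by_cases h : k = N.k₀
  · subst h; simp [initList]
  · simp [initList, h]

theorem haltList_stk_eq (N : FinTM2) (l : List (N.Γ N.k₁)) :
    (haltList N l).stk = update (fun _ => []) N.k₁ l := by
  funext k
  by_cases h : k = N.k₁
  · subst h; simp [haltList]
  · simp [haltList, h]

/-- The simulation is step by step, with no slowdown: the step that halts procedure `i` becomes the
step that jumps to `exit`. -/
theorem reachesIn_liftStmt {Λ : Type} (P : Λ → TM2.Stmt (StackSym R A B M) Λ (Mem A M)) (i : ι)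
    (lab : (M i).Λ → Λ) (exit : Λ) (hP : ∀ y, P (lab y) = liftStmt i lab exit ((M i).m y))
    (o : Option A) (I : ∀ i, (M i).σ) (S : R → List A) (T : List B)
    (W : ∀ i, ∀ k, List ((M i).Γ k)) (n : ℕ) (l : (M i).Λ) (v : (M i).σ)
    (U : ∀ k, List ((M i).Γ k)) (c' : (M i).Cfg) (hc' : c'.l = none)
    (h : (flip bind (M i).step)^[n] (some ⟨some l, v, U⟩) = some c') :
    ReachesIn (TM2.step P) n ⟨some (lab l), (o, update I i v), stk S T (update W i U)⟩
      ⟨some exit, (o, update I i c'.var), stk S T (update W i c'.stk)⟩ := by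
  induction n generalizing l v U with
  | zero =>
    have h : (some ⟨some l, v, U⟩ : Option (M i).Cfg) = some c' := h
    cases h
    cases hc'
  | succ n ih =>
    rw [iterate_succ_apply] at h
    have hs : flip bind (M i).step (some ⟨some l, v, U⟩) =
      some (TM2.stepAux ((M i).m l) v U) := rfl
    rw [hs] at h
    have hstep : ReachesIn (TM2.step P) 1
        ⟨some (lab l), (o, update I i v), stk S T (update W i U)⟩ _ := .single rfl
    rw [hP, stepAux_liftStmt] at hstep
    rw [add_comm]
    refine hstep.trans ?_
    rcases hq : TM2.stepAux ((M i).m l) v U with ⟨_ | l', v', U'⟩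
    · rw [hq] at h
      -- The procedure has just halted. A further step would yield `none`, so this was the last one.
      rcases n with _ | n
      · have h : (some ⟨none, v', U'⟩ : Option (M i).Cfg) = some c' := h
        cases h
        exact ReachesIn.refl _ _ _
      · have h : (flip bind (M i).step)^[n] none = some c' := h
        rw [iterate_bind_none] at h
        cases h
    · rw [hq] at h
      exact ih l' v' U' h

variable [Inhabited A]

/-- The statements of a compiled program, which proceeds to the label `exit` at its end. -/
def compile (enc : ∀ i, A → (M i).Γ (M i).k₀) (dec : ∀ i, (M i).Γ (M i).k₁ → A) {Λ : Type} :
    ∀ c : Cmd R A ι, (Lab M c → Λ) → Λ → Lab M c → TM2.Stmt (StackSym R A B M) Λ (Mem A M)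
  | .skip, _, exit, _ => .goto fun _ => exit
  | .push r a, _, exit, _ => .push (.inl r) (fun _ => a) (.goto fun _ => exit)
  | .pop r next, emb, exit, x =>
    match x with
    | none => .pop (.inl r) (fun v s => (s, v.2))
        (.goto fun v => emb (some ⟨v.1, entry M (next v.1)⟩))
    | some ⟨a, y⟩ => compile enc dec (next a) (fun z => emb (some ⟨a, z⟩)) exit y
  | .seq c d, emb, exit, x =>
    match x with
    | .inl y => compile enc dec c (fun z => emb (.inl z)) (emb (.inr (entry M d))) y
    | .inr y => compile enc dec d (fun z => emb (.inr z)) exit y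
  | .loop r p body, emb, exit, x =>
    match x with
    | none => .peek (.inl r) (fun v s => (s, v.2))
        (.goto fun v => bif p v.1 then emb (some (entry M body)) else exit)
    | some y => compile enc dec body (fun z => emb (some z)) (emb none) y
  | .call i src dst, emb, exit, x =>
    match x with
    | .inl y => liftStmt i (fun z => emb (.inl z)) (emb (.inr true)) ((M i).m y)
    | .inr false => .pop (.inl src) (fun v s => (s, v.2))
        (.branch (fun v => v.1.isSome)
          (.push (.inr (.inr ⟨i, (M i).k₀⟩)) (fun v => enc i (v.1.getD default))
            (.goto fun _ => emb (.inr false)))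
          (.goto fun _ => emb (.inl (M i).main)))
    | .inr true => .pop (.inr (.inr ⟨i, (M i).k₁⟩)) (fun v s => (s.map (dec i), v.2))
        (.branch (fun v => v.1.isSome)
          (.push (.inl dst) (fun v => v.1.getD default) (.goto fun _ => emb (.inr true)))
          (.goto fun _ => exit))

/-- The relation computed by procedure `i` when it is the machine `M i`. -/
def MachineOracle (M : ι → FinTM2) (enc : ∀ i, A → (M i).Γ (M i).k₀)
    (dec : ∀ i, (M i).Γ (M i).k₁ → A) (i : ι) (l o : List A) (t : ℕ) : Prop :=
  ∃ o', Nonempty (TM2OutputsInTime (M i) (l.map (enc i)) (some o') t) ∧ o = o'.map (dec i)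

/-- Moving symbols between stacks reverses them, which is why a call passes the reverse of its
source register. The `default` symbol is never pushed, since the branch is taken only after a
successful pop. -/
theorem reachesIn_feed {Λ : Type} (P : Λ → TM2.Stmt (StackSym R A B M) Λ (Mem A M)) (i : ι)
    (enc : A → (M i).Γ (M i).k₀) (src : R) (feed next : Λ)
    (hP : P feed = .pop (.inl src) (fun v s => (s, v.2))
        (.branch (fun v => v.1.isSome)
          (.push (.inr (.inr ⟨i, (M i).k₀⟩)) (fun v => enc (v.1.getD default))
            (.goto fun _ => feed))
          (.goto fun _ => next)))
    (I : ∀ i, (M i).σ) (T : List B) (W : ∀ i, ∀ k, List ((M i).Γ k)) (l : List A)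
    (o : Option A) (S : R → List A) (hS : S src = l) (U : List ((M i).Γ (M i).k₀)) :
    ReachesIn (TM2.step P) (l.length + 1)
      ⟨some feed, (o, I), stk S T (update W i (update (fun _ => []) (M i).k₀ U))⟩
      ⟨some next, (none, I), stk (update S src []) T
        (update W i (update (fun _ => []) (M i).k₀ ((l.map enc).reverse ++ U)))⟩ := by
  induction l generalizing o S U with
  | nil =>
    refine .single ?_
    simp [hP, update_stk_reg, stk, hS]
  | cons a l ih =>
    have h := ih (some a) (update S src l) (by simp) (enc a :: U)
    rw [List.length_cons, add_comm]
    refine (ReachesIn.single ?_).trans (h.mono le_rfl |> fun h => by simpa using h)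
    simp [hP, update_stk_reg, update_stk_proc, stk, hS]

theorem reachesIn_fetch {Λ : Type} (P : Λ → TM2.Stmt (StackSym R A B M) Λ (Mem A M)) (i : ι)
    (dec : (M i).Γ (M i).k₁ → A) (dst : R) (fetch next : Λ)
    (hP : P fetch = .pop (.inr (.inr ⟨i, (M i).k₁⟩)) (fun v s => (s.map dec, v.2))
        (.branch (fun v => v.1.isSome)
          (.push (.inl dst) (fun v => v.1.getD default) (.goto fun _ => fetch))
          (.goto fun _ => next)))
    (I : ∀ i, (M i).σ) (T : List B) (W : ∀ i, ∀ k, List ((M i).Γ k))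
    (U : List ((M i).Γ (M i).k₁)) (o : Option A) (S : R → List A) :
    ReachesIn (TM2.step P) (U.length + 1)
      ⟨some fetch, (o, I), stk S T (update W i (update (fun _ => []) (M i).k₁ U))⟩
      ⟨some next, (none, I), stk (update S dst ((U.map dec).reverse ++ S dst)) T
        (update W i (fun _ => []))⟩ := by
  induction U generalizing o S with
  | nil =>
    refine .single ?_
    have : update W i (update (fun _ => []) (M i).k₁ []) = update W i (fun _ => []) := by
      congr 1; exact update_eq_self _ _
    simp [hP, update_stk_proc, stk]
  | cons a U ih =>
    have h := ih (some (dec a)) (update S dst (dec a :: S dst))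
    rw [List.length_cons, add_comm]
    refine (ReachesIn.single ?_).trans (h.mono le_rfl |> fun h => by simpa using h)
    simp [hP, update_stk_proc, update_stk_reg, stk]

/-- Between two commands, all procedure stacks are empty and all procedure memories are initial;
only the last symbol read is arbitrary. This invariant makes the procedures callable any number of
times. It survives a call because a machine that outputs in the sense of `haltList` leaves its other
stacks empty and its memory initial. -/
theorem Runs.reachesIn {enc : ∀ i, A → (M i).Γ (M i).k₀} {dec : ∀ i, (M i).Γ (M i).k₁ → A}
    {Λ : Type} (P : Λ → TM2.Stmt (StackSym R A B M) Λ (Mem A M)) {c : Cmd R A ι}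
    {S S' : R → List A} {t : ℕ} (h : Runs (MachineOracle M enc dec) c S S' t)
    (emb : Lab M c → Λ) (exit : Λ) (hP : ∀ x, P (emb x) = compile enc dec c emb exit x)
    (T : List B) (o : Option A) :
    ∃ o', ReachesIn (TM2.step P) t
      ⟨some (emb (entry M c)), (o, fun i => (M i).initialState), stk S T fun _ _ => []⟩
      ⟨some exit, (o', fun i => (M i).initialState), stk S' T fun _ _ => []⟩ := by
  induction h generalizing exit o with
  | skip S => exact ⟨o, .single (by simp [hP, compile])⟩
  | push r a S => exact ⟨o, .single (by simp [hP, compile, update_stk_reg, stk])⟩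
  | @pop r next S S' t h ih =>
    obtain ⟨o', h'⟩ := ih (fun z => emb (some ⟨_, z⟩)) exit (fun x => hP _) (S r).head?
    refine ⟨o', (ReachesIn.trans (.single ?_) h').mono (by omega)⟩
    have e := hP none
    simp [e, compile, entry, update_stk_reg, stk]
  | @seq c d S S' S'' t u h h' ih ih' =>
    obtain ⟨o', h₁⟩ := ih (fun z => emb (.inl z)) (emb (.inr (entry M d))) (fun x => hP _) o
    obtain ⟨o'', h₂⟩ := ih' (fun z => emb (.inr z)) exit (fun x => hP _) o'
    exact ⟨o'', h₁.trans h₂⟩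
  | @loop_exit r p body S h =>
    have e := hP none
    exact ⟨(S r).head?, .single (by simp [e, compile, entry, stk, h])⟩
  | @loop_step r p body S S' S'' t u h hb hl ih ih' =>
    obtain ⟨o', h₁⟩ := ih (fun z => emb (some z)) (emb none) (fun x => hP _) (S r).head?
    obtain ⟨o'', h₂⟩ := ih' emb exit hP o'
    refine ⟨o'', (ReachesIn.trans (.single ?_) (h₁.trans h₂)).mono (by omega)⟩
    have e := hP none
    simp [e, compile, entry, stk, h]
  | @call i src dst S out t h =>
    obtain ⟨out', ⟨⟨⟨n, hn⟩, hnt⟩⟩, rfl⟩ := h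
    have h₁ := reachesIn_feed P i (enc i) src (emb (.inr false)) (emb (.inl (M i).main))
      (hP _) (fun i => (M i).initialState) T (fun _ _ => []) _ o S rfl []
    have h₂ := reachesIn_liftStmt P i (fun z => emb (.inl z)) (emb (.inr true)) (fun y => hP _)
      none (fun i => (M i).initialState) (update S src []) T (fun _ _ => []) n _ _ _ _ rfl hn
    have h₃ := reachesIn_fetch P i (dec i) dst (emb (.inr true)) exit
      (hP _) (fun i => (M i).initialState) T (fun _ _ => []) out' none (update S src [])
    -- Feeding, running and fetching. Each transfer needs one extra step to notice the empty stack,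
    -- hence the 2 in the cost of a call.
    refine ⟨none, ReachesIn.mono (n := (S src).length + 1 + n + (out'.length + 1)) ?_
      (by simp at hnt ⊢; omega)⟩
    have eI : update (fun i => (M i).initialState) i (M i).initialState =
        fun i => (M i).initialState := update_eq_self i _
    have eI' : update (fun i => (M i).initialState) i (haltList (M i) out').var =
        fun i => (M i).initialState := eI
    rw [eI, eI'] at h₂
    refine ReachesIn.trans (ReachesIn.trans ?_ h₂) ?_
    · have e : update (fun _ _ => [] : ∀ i, ∀ k, List ((M i).Γ k)) i
          (update (fun _ => []) (M i).k₀ []) = fun _ _ => [] := by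
        rw [update_eq_self (f := fun _ => []) (M i).k₀]; exact update_eq_self _ _
      have e' := initList_stk_eq (M i) (((S src).reverse).map (enc i))
      rw [e] at h₁
      simp only [initList] at e'
      rw [e']
      simp only [List.append_nil, ← List.map_reverse] at h₁
      exact h₁
    · have e' := haltList_stk_eq (M i) out'
      rw [e']
      have e : update (fun _ _ => [] : ∀ i, ∀ k, List ((M i).Γ k)) i (fun _ => []) =
          fun _ _ => [] := update_eq_self _ _
      rw [e] at h₃
      simp only [← List.map_reverse] at h₃ ⊢
      exact h₃
  | mono h htu ih =>
    obtain ⟨o', h'⟩ := ih emb exit hP o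
    exact ⟨o', h'.mono htu⟩

/-- The machine that runs a program on the input register `inp` and then moves the symbols of the
output register `out` to its output stack. -/
noncomputable def machine [Fintype R] [Fintype A] [Fintype ι]
    (M : ι → FinTM2) (enc : ∀ i, A → (M i).Γ (M i).k₀)
    (dec : ∀ i, (M i).Γ (M i).k₁ → A) (f : A → B) (c : Cmd R A ι) (inp out : R) : FinTM2 :=
  haveI := fintypeLab M c
  haveI := fun i => (M i).kFin
  haveI := fun i => (M i).σFin
  { K := StackIdx R M
    k₀ := .inl inp
    k₁ := .inr (.inl ())
    Γ := StackSym R A B M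
    Λ := Option (Lab M c)
    main := some (entry M c)
    σ := Mem A M
    initialState := (none, fun i => (M i).initialState)
    Γk₀Fin := inferInstanceAs (Fintype A)
    m := fun x => match x with
      | some y => compile enc dec c some none y
      | none => .pop (.inl out) (fun v s => (s, v.2))
        (.branch (fun v => v.1.isSome)
          (.push (.inr (.inl ())) (fun v => f (v.1.getD default)) (.goto fun _ => none))
          .halt) }

theorem reachesIn_output {Λ : Type} (P : Λ → TM2.Stmt (StackSym R A B M) Λ (Mem A M))
    (f : A → B) (out : R) (last : Λ)
    (hP : P last = .pop (.inl out) (fun v s => (s, v.2))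
        (.branch (fun v => v.1.isSome)
          (.push (.inr (.inl ())) (fun v => f (v.1.getD default)) (.goto fun _ => last))
          .halt))
    (I : ∀ i, (M i).σ) (W : ∀ i, ∀ k, List ((M i).Γ k)) (l : List A)
    (o : Option A) (S : R → List A) (hS : S out = l) (T : List B) :
    ReachesIn (TM2.step P) (l.length + 1) ⟨some last, (o, I), stk S T W⟩
      ⟨none, (none, I), stk (update S out []) ((l.map f).reverse ++ T) W⟩ := by
  induction l generalizing o S T with
  | nil =>
    refine .single ?_
    simp [hP, update_stk_reg, stk, hS]
  | cons a l ih =>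
    have h := ih (some a) (update S out l) (by simp) (f a :: T)
    rw [List.length_cons, add_comm]
    refine (ReachesIn.single ?_).trans (h.mono le_rfl |> fun h => by simpa using h)
    simp [hP, update_stk_reg, update_stk_out, stk, hS]

/-- `haltList` requires every stack but the output stack to be empty, so a program has to clear all
registers other than `out`. The final transfer reverses, so programs leave their result reversed in
`out`. -/
theorem Runs.outputsInTime [Fintype R] [Fintype A] [Fintype ι] {enc : ∀ i, A → (M i).Γ (M i).k₀}
    {dec : ∀ i, (M i).Γ (M i).k₁ → A} (f : A → B) {c : Cmd R A ι} {inp out : R} {l o : List A}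
    {t : ℕ} (h : Runs (MachineOracle M enc dec) c (update (fun _ => []) inp l)
      (update (fun _ => []) out o) t) :
    Nonempty (TM2OutputsInTime (machine M enc dec f c inp out) l (some (o.map f).reverse)
      (t + (o.length + 1))) := by
  obtain ⟨s, h₁⟩ := h.reachesIn (machine M enc dec f c inp out).m some none (fun _ => rfl) [] none
  have h₂ := reachesIn_output (machine M enc dec f c inp out).m f out none rfl
    (fun i => (M i).initialState) (fun _ _ => []) o s (update (fun _ => []) out o) (by simp) []
  obtain ⟨n, hn, e⟩ := h₁.trans h₂
  refine ⟨⟨⟨n, ?_⟩, hn⟩⟩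
  have e₁ : initList (machine M enc dec f c inp out) l =
      ⟨some (some (entry M c)), (none, fun i => (M i).initialState),
        stk (update (fun _ => []) inp l) [] fun _ _ => []⟩ := by
    have e : stk (B := B) (M := M) (update (fun _ => []) inp l) [] (fun _ _ => []) =
        update (β := fun k => List (StackSym R A B M k)) (fun _ => []) (.inl inp) l := by
      rw [← update_stk_reg]
      congr 1
      funext k; rcases k with r' | _ | ⟨i, k⟩ <;> rfl
    exact congrArg (fun s => (⟨some (some (entry M c)), (none, fun i => (M i).initialState), s⟩ :
      TM2.Cfg (StackSym R A B M) (Option (Lab M c)) (Mem A M)))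
        ((initList_stk_eq (machine M enc dec f c inp out) l).trans e.symm)
  have e₂ : haltList (machine M enc dec f c inp out) (o.map f).reverse =
      ⟨none, (none, fun i => (M i).initialState),
        stk (fun _ => []) (o.map f).reverse fun _ _ => []⟩ := by
    have e : stk (R := R) (A := A) (M := M) (fun _ => []) (o.map f).reverse (fun _ _ => []) =
        update (β := fun k => List (StackSym R A B M k)) (fun _ => []) (.inr (.inl ()))
          (o.map f).reverse := by
      rw [← update_stk_out (T := [])]
      congr 1
      funext k; rcases k with r' | _ | ⟨i, k⟩ <;> rfl
    exact congrArg (fun s => (⟨none, (none, fun i => (M i).initialState), s⟩ :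
      TM2.Cfg (StackSym R A B M) (Option (Lab M c)) (Mem A M)))
        ((haltList_stk_eq (machine M enc dec f c inp out) (o.map f).reverse).trans e.symm)
  have e₃ : update (update (fun _ => []) out o) out [] = (fun _ => [] : R → List A) := by
    rw [update_idem]; exact update_eq_self _ _
  rw [e₃, List.append_nil] at e
  exact (congrArg (fun c' => (flip bind (machine M enc dec f c inp out).step)^[n] (some c'))
    e₁).trans (e.trans (congrArg some e₂.symm))

end Compile

end Cmd

/-! ### Output length -/

/-- The number of symbols that a statement pushes at most. -/
def pushCount {K : Type} {Γ : K → Type} {Λ σ : Type} : TM2.Stmt Γ Λ σ → ℕ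
  | .push _ _ q => pushCount q + 1
  | .peek _ _ q => pushCount q
  | .pop _ _ q => pushCount q
  | .load _ q => pushCount q
  | .branch _ q₁ q₂ => pushCount q₁ + pushCount q₂
  | .goto _ => 0
  | .halt => 0

theorem length_stepAux_le {K : Type} [DecidableEq K] {Γ : K → Type} {Λ σ : Type}
    (q : TM2.Stmt Γ Λ σ) (v : σ) (S : ∀ k, List (Γ k)) (k : K) :
    ((TM2.stepAux q v S).stk k).length ≤ (S k).length + pushCount q := by
  induction q generalizing v S with
  | push k' f q ih =>
    refine (ih _ _).trans ?_
    by_cases h : k = k'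
    · subst h; simp [pushCount]; omega
    · simp [pushCount, h]; try omega
  | peek k' f q ih => exact ih _ _
  | pop k' f q ih =>
    refine (ih _ _).trans ?_
    by_cases h : k = k'
    · subst h; simp [pushCount]
    · simp [pushCount, h]
  | load f q ih => exact ih _ _
  | branch f q₁ q₂ ih₁ ih₂ =>
    simp only [TM2.stepAux, pushCount]
    cases f v
    · exact (ih₂ _ _).trans (by omega)
    · exact (ih₁ _ _).trans (by omega)
  | goto f => simp [pushCount]
  | halt => simp [pushCount]

/-- The length of the output of a machine is at most linear in the length of its input and its
running time. -/
theorem exists_output_length_le (N : FinTM2) : ∃ C, ∀ l o t,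
    Nonempty (TM2OutputsInTime N l (some o) t) → o.length ≤ l.length + t * C := by
  have := N.ΛFin
  refine ⟨∑ x, pushCount (N.m x), fun l o t ⟨⟨⟨n, hn⟩, hnt⟩⟩ => ?_⟩
  have key : ∀ (n : ℕ) (c c' : N.Cfg) (k : N.K), (flip bind N.step)^[n] (some c) = some c' →
      (c'.stk k).length ≤ (c.stk k).length + n * ∑ x, pushCount (N.m x) := by
    intro n
    induction n with
    | zero =>
      intro c c' k h
      cases h
      omega
    | succ n ih =>
      intro c c' k h
      rw [iterate_succ_apply] at h
      obtain ⟨_ | x, v, S⟩ := c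
      · have h : (flip bind N.step)^[n] none = some c' := h
        rw [Cmd.iterate_bind_none] at h
        cases h
      · have h₁ := ih (TM2.stepAux (N.m x) v S) c' k h
        have h₂ := length_stepAux_le (N.m x) v S k
        have h₃ : pushCount (N.m x) ≤ ∑ x, pushCount (N.m x) :=
          Finset.single_le_sum (f := fun x => pushCount (N.m x)) (fun _ _ => Nat.zero_le _)
            (Finset.mem_univ x)
        refine h₁.trans ((Nat.add_le_add_right h₂ _).trans ?_)
        simp only [add_mul, one_mul]
        omega
  have h := key n _ _ N.k₁ hn
  rw [Cmd.haltList_stk_eq, update_self] at h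
  have h' : ((initList N l).stk N.k₁).length ≤ l.length := by
    rw [Cmd.initList_stk_eq]
    by_cases e : N.k₁ = N.k₀
    · rw [e]; simp
    · simp [e]
  have : n * ∑ x, pushCount (N.m x) ≤ t * ∑ x, pushCount (N.m x) := Nat.mul_le_mul_right _ hnt
  omega

end SubgroupDiscovery

namespace SubgroupDiscovery

open Computability Turing Function

namespace Cmd

variable {R A ι : Type} [DecidableEq R] {O : ι → List A → List A → ℕ → Prop}

/-! ### Derived commands -/

theorem Runs.of_eq {c : Cmd R A ι} {S S' S'' : R → List A} {t u : ℕ} (h : Runs O c S S' t)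
    (hS : S' = S'') (htu : t ≤ u) : Runs O c S S'' u :=
  hS ▸ h.mono htu

theorem Runs.congr {c : Cmd R A ι} {S₀ S S' S'' : R → List A} {t u : ℕ} (h : Runs O c S S' t)
    (hS₀ : S₀ = S) (hS : S' = S'') (htu : t ≤ u) : Runs O c S₀ S'' u :=
  hS₀ ▸ hS ▸ h.mono htu

/-- Pop all symbols from `src`, and run `f` on each of them. -/
def drain (src : R) (f : A → Cmd R A ι) : Cmd R A ι :=
  loop src Option.isSome (pop src fun o => o.elim skip f)

/-- Pop all symbols up to the first one that satisfies `p`, which is popped as well, and run `f` on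
all others. -/
def drainUntil (p : A → Bool) (src : R) (f : A → Cmd R A ι) : Cmd R A ι :=
  seq (loop src (fun o => o.any (!p ·)) (pop src fun o => o.elim skip f)) (pop src fun _ => skip)

def clear (r : R) : Cmd R A ι := drain r fun _ => skip

def move (src dst : R) : Cmd R A ι := drain src fun a => push dst a

def dup (src d₁ d₂ : R) : Cmd R A ι := drain src fun a => seq (push d₁ a) (push d₂ a)

def copy (tmp src dst : R) : Cmd R A ι := seq (move src tmp) (dup tmp src dst)

def copyRev (tmp src dst : R) : Cmd R A ι := seq (dup src tmp dst) (move tmp src)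

def moveUntil (p : A → Bool) (src dst : R) : Cmd R A ι := drainUntil p src fun a => push dst a

def dupUntil (p : A → Bool) (src d₁ d₂ : R) : Cmd R A ι :=
  drainUntil p src fun a => seq (push d₁ a) (push d₂ a)

/-- Push the symbols of a word one by one. -/
def pushAll (dst : R) : List A → Cmd R A ι
  | [] => skip
  | a :: l => seq (push dst a) (pushAll dst l)

theorem runs_pushAll (dst : R) (l : List A) (S : R → List A) :
    Runs O (pushAll dst l) S (update S dst (l.reverse ++ S dst)) (l.length + 1) := by
  induction l generalizing S with
  | nil => exact (Runs.skip S).of_eq (by simp) (by simp)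
  | cons a l ih =>
    exact ((Runs.push dst a S).seq (ih _)).of_eq (by simp) (by simp; omega)

theorem runs_clear (r : R) (S : R → List A) :
    Runs O (clear r) S (update S r []) (3 * (S r).length + 1) := by
  generalize hl : S r = l
  induction l generalizing S with
  | nil =>
    exact (Runs.loop_exit (by simp [hl])).of_eq (by rw [← hl, update_eq_self]) (by simp)
  | cons a l ih =>
    have h := ih (update S r l) (by simp)
    refine (Runs.loop_step (t := 2) (by simp [hl]) (.pop ?_) h).of_eq (by simp)
      (by simp; omega)
    simpa [hl] using Runs.skip _

theorem runs_move {src dst : R} (hne : src ≠ dst) (S : R → List A) :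
    Runs O (move src dst) S (update (update S src []) dst ((S src).reverse ++ S dst))
      (3 * (S src).length + 1) := by
  generalize hl : S src = l
  induction l generalizing S with
  | nil =>
    refine (Runs.loop_exit (by simp [hl])).of_eq ?_ (by simp)
    funext r
    simp only [update_apply]
    split_ifs <;> simp_all
  | cons a l ih =>
    have h := ih (update (update S src l) dst (a :: S dst)) (by simp [hne])
    refine (Runs.loop_step (t := 2) (by simp [hl]) (.pop ?_) h).of_eq ?_
      (by simp; omega)
    · simpa [hl, hne.symm] using Runs.push dst a (update S src l)
    · funext r
      simp only [update_apply]
      split_ifs <;> simp_all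

theorem runs_dup {src d₁ d₂ : R} (h₁ : src ≠ d₁) (h₂ : src ≠ d₂) (h₁₂ : d₁ ≠ d₂)
    (S : R → List A) :
    Runs O (dup src d₁ d₂) S (update (update (update S src []) d₁ ((S src).reverse ++ S d₁)) d₂
      ((S src).reverse ++ S d₂)) (4 * (S src).length + 1) := by
  generalize hl : S src = l
  induction l generalizing S with
  | nil =>
    refine (Runs.loop_exit (by simp [hl])).of_eq ?_ (by simp)
    funext r
    simp only [update_apply]
    split_ifs <;> simp_all
  | cons a l ih =>
    have h := ih (update (update (update S src l) d₁ (a :: S d₁)) d₂ (a :: S d₂))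
      (by simp [h₁, h₂])
    refine (Runs.loop_step (t := 3) (by simp [hl]) (.pop ?_) h).of_eq ?_
      (by simp; omega)
    · simpa [hl, h₁.symm, h₂.symm, h₁₂.symm] using
        (Runs.push (O := O) d₁ a (update S src l)).seq (Runs.push d₂ a _)
    · funext r
      simp only [update_apply]
      split_ifs <;> simp_all

/-- The two passes through `tmp` reverse twice, so the order is kept and `src` is restored. -/
theorem runs_copy {tmp src dst : R} (h₁ : tmp ≠ src) (h₂ : tmp ≠ dst) (h₁₂ : src ≠ dst)
    (S : R → List A) (hS : S tmp = []) :
    Runs O (copy tmp src dst) S (update S dst (S src ++ S dst)) (7 * (S src).length + 2) := by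
  refine ((runs_move h₁.symm S).seq (runs_dup h₁ h₂ h₁₂ _)).of_eq ?_ (by simp [hS]; omega)
  funext r
  simp only [update_apply]
  split_ifs <;> simp_all

theorem runs_copyRev {tmp src dst : R} (h₁ : tmp ≠ src) (h₂ : tmp ≠ dst) (h₁₂ : src ≠ dst)
    (S : R → List A) (hS : S tmp = []) :
    Runs O (copyRev tmp src dst) S (update S dst ((S src).reverse ++ S dst))
      (7 * (S src).length + 2) := by
  refine ((runs_dup h₁.symm h₁₂ h₂ S).seq (runs_move h₁ _)).of_eq ?_ (by simp [hS, h₂]; omega)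
  funext r
  simp only [update_apply]
  split_ifs <;> simp_all

theorem runs_moveUntil {p : A → Bool} {src dst : R} (hne : src ≠ dst) (S : R → List A)
    {l l' : List A} {e : A} (hS : S src = l ++ e :: l') (hl : ∀ a ∈ l, p a = false)
    (he : p e = true) :
    Runs O (moveUntil p src dst) S (update (update S src l') dst (l.reverse ++ S dst))
      (3 * l.length + 3) := by
  suffices h : Runs O (loop src (fun o => o.any (!p ·)) (pop src fun o => o.elim skip (push dst)))
      S (update (update S src (e :: l')) dst (l.reverse ++ S dst)) (3 * l.length + 1) by
    refine (h.seq (.pop (.skip _))).of_eq ?_ (by omega)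
    funext r
    simp only [update_apply]
    split_ifs <;> simp_all
  induction l generalizing S with
  | nil =>
    refine (Runs.loop_exit (by simp_all)).of_eq ?_ (by simp)
    simp only [List.nil_append] at hS
    rw [← hS]; simp
  | cons a l ih =>
    have h := ih (update (update S src (l ++ e :: l')) dst (a :: S dst)) (by simp [hne])
      fun a ha => hl a (by simp [ha])
    refine (Runs.loop_step (t := 2) (by simp [hS, hl]) (.pop ?_) h).of_eq ?_
      (by simp; omega)
    · simpa [hS, hne.symm] using Runs.push dst a (update S src (l ++ e :: l'))
    · funext r
      simp only [update_apply]
      split_ifs <;> simp_all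

theorem runs_dupUntil {p : A → Bool} {src d₁ d₂ : R} (h₁ : src ≠ d₁) (h₂ : src ≠ d₂)
    (h₁₂ : d₁ ≠ d₂) (S : R → List A) {l l' : List A} {e : A} (hS : S src = l ++ e :: l')
    (hl : ∀ a ∈ l, p a = false) (he : p e = true) :
    Runs O (dupUntil p src d₁ d₂) S (update (update (update S src l') d₁ (l.reverse ++ S d₁)) d₂
      (l.reverse ++ S d₂)) (4 * l.length + 3) := by
  suffices h : Runs O (loop src (fun o => o.any (!p ·))
      (pop src fun o => o.elim skip fun a => seq (push d₁ a) (push d₂ a)))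
      S (update (update (update S src (e :: l')) d₁ (l.reverse ++ S d₁)) d₂
      (l.reverse ++ S d₂)) (4 * l.length + 1) by
    refine (h.seq (.pop (.skip _))).of_eq ?_ (by omega)
    funext r
    simp only [update_apply]
    split_ifs <;> simp_all
  induction l generalizing S with
  | nil =>
    refine (Runs.loop_exit (by simp_all)).of_eq ?_ (by simp)
    simp only [List.nil_append] at hS
    rw [← hS]; simp
  | cons a l ih =>
    have h := ih (update (update (update S src (l ++ e :: l')) d₁ (a :: S d₁)) d₂ (a :: S d₂))
      (by simp [h₁, h₂]) fun a ha => hl a (by simp [ha])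
    refine (Runs.loop_step (t := 3) (by simp [hS, hl]) (.pop ?_) h).of_eq ?_
      (by simp; omega)
    · simpa [hS, h₁.symm, h₂.symm, h₁₂.symm] using
        (Runs.push (O := O) d₁ a (update S src (l ++ e :: l'))).seq (Runs.push d₂ a _)
    · funext r
      simp only [update_apply]
      split_ifs <;> simp_all

/-- Run `body` on all words in `src`, each of which ends with a symbol that satisfies `p`. The word
is given to `body` in reverse on the stack `cur`. -/
def forEach (p : A → Bool) (e : A) (src cur done : R) (body : Cmd R A ι) : Cmd R A ι :=
  seq (loop src Option.isSome
    (seq (dupUntil p src cur done) (seq (push done e) body))) (move done src)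

/-- `body` may change only the accumulator `x` and must empty `cur`; its hypothesis ranges over all
stores that agree with `S` off the four working registers, since these vary from word to word. The
results pile up on `x`, hence the reversed list. The stack `done` collects the words that were read,
so that `src` can be restored at the end. -/
theorem runs_forEach {p : A → Bool} {e : A} (he : p e = true) {src cur done x : R}
    (h₁ : src ≠ cur) (h₂ : src ≠ done) (h₃ : cur ≠ done) (h₄ : x ≠ src) (h₅ : x ≠ cur)
    (h₆ : x ≠ done) {body : Cmd R A ι} {f : List A → List A} {gs : List (List A)} {L t : ℕ}
    (hgs : ∀ g ∈ gs, g.length ≤ L ∧ ∀ a ∈ g, p a = false) {S : R → List A}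
    (hsrc : S src = gs.flatMap (· ++ [e])) (hcur : S cur = []) (hdone : S done = [])
    (hbody : ∀ g ∈ gs, ∀ S' : R → List A,
      (∀ r, r ≠ src → r ≠ cur → r ≠ done → r ≠ x → S' r = S r) → S' cur = g.reverse →
      Runs O body S' (update (update S' x (f g ++ S' x)) cur []) t) :
    Runs O (forEach p e src cur done body) S (update S x (gs.reverse.flatMap f ++ S x))
      (gs.length * (7 * L + t + 8) + 2) := by
  -- The induction needs the loop alone, from any intermediate store, because `x` and `done` grow
  -- during it.
  suffices h : ∀ S' : R → List A,
      (∀ r, r ≠ src → r ≠ cur → r ≠ done → r ≠ x → S' r = S r) →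
      S' src = gs.flatMap (· ++ [e]) → S' cur = [] →
      Runs O (loop src Option.isSome (seq (dupUntil p src cur done) (seq (push done e) body))) S'
        (update (update (update S' src []) x (gs.reverse.flatMap f ++ S' x)) done
          ((gs.flatMap (· ++ [e])).reverse ++ S' done)) (gs.length * (4 * L + t + 5) + 1) by
    refine ((h S (fun _ _ _ _ _ => rfl) hsrc hcur).seq (runs_move h₂.symm _)).of_eq ?_ ?_
    · funext r
      simp only [update_apply]
      split_ifs <;> simp_all
    · have : (gs.flatMap (· ++ [e])).length ≤ gs.length * (L + 1) := by
        rw [List.length_flatMap, ← List.length_map (f := fun g => (g ++ [e]).length)]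
        refine (List.sum_le_card_nsmul _ (L + 1) ?_).trans (by simp)
        intro n hn
        obtain ⟨g, hg, rfl⟩ := List.mem_map.1 hn
        simpa using (hgs g hg).1
      simp only [update_self, hdone, List.append_nil, List.length_reverse]
      nlinarith
  clear hsrc hcur hdone
  induction gs with
  | nil =>
    intro S' _ hsrc _
    refine (Runs.loop_exit (by simp [hsrc])).of_eq ?_ (by simp)
    funext r
    simp only [update_apply]
    split_ifs <;> simp_all
  | cons g gs ih =>
    intro S' hS' hsrc hcur
    have hg := hgs g (by simp)
    have hd := runs_dupUntil (O := O) (p := p) h₁ h₂ h₃ S' (l := g) (e := e)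
      (l' := gs.flatMap (· ++ [e])) (by rw [hsrc]; simp) hg.2 he
    have hp := Runs.push (O := O) done e (update (update (update S' src
      (gs.flatMap (· ++ [e]))) cur (g.reverse ++ S' cur)) done (g.reverse ++ S' done))
    rw [update_self, update_idem, hcur, List.append_nil] at hp
    rw [hcur, List.append_nil] at hd
    have hb := hbody g (by simp) (update (update (update S' src
      (gs.flatMap (· ++ [e]))) cur g.reverse) done (e :: (g.reverse ++ S' done)))
      (fun r hr₁ hr₂ hr₃ hr₄ => by simp [hr₁, hr₂, hr₃, hS' r hr₁ hr₂ hr₃ hr₄])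
      (by simp [h₃])
    generalize hS₁ : update (update (update (update (update S' src _) cur g.reverse) done _) x _)
      cur [] = S₁ at hb
    have e₁ : S₁ src = gs.flatMap (· ++ [e]) := by subst hS₁; simp [h₁, h₂, h₄.symm]
    have e₂ : S₁ cur = [] := by subst hS₁; simp
    have e₃ : S₁ done = e :: (g.reverse ++ S' done) := by subst hS₁; simp [h₃.symm, h₆.symm]
    have e₄ : S₁ x = f g ++ S' x := by subst hS₁; simp [h₄, h₅, h₆]
    have e₅ : ∀ r, r ≠ src → r ≠ cur → r ≠ done → r ≠ x → S₁ r = S' r := by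
      intro r hr₁ hr₂ hr₃ hr₄
      subst hS₁; simp [hr₁, hr₂, hr₃, hr₄]
    refine (Runs.loop_step (by rw [hsrc]; cases g <;> simp) (hd.seq (hp.seq hb))
      (ih (fun g hg => hgs g (by simp [hg])) (fun g hg => hbody g (by simp [hg])) S₁
        ?_ e₁ e₂)).of_eq ?_ ?_
    · intro r hr₁ hr₂ hr₃ hr₄
      rw [e₅ r hr₁ hr₂ hr₃ hr₄, hS' r hr₁ hr₂ hr₃ hr₄]
    · funext r
      by_cases hr₃ : r = done
      · subst hr₃; simp [e₃]
      by_cases hr₄ : r = x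
      · subst hr₄; simp [e₄, h₆]
      by_cases hr₁ : r = src
      · subst hr₁; simp [hr₃, hr₄]
      by_cases hr₂ : r = cur
      · subst hr₂; simp [hr₃, hr₄, hr₁, e₂, hcur]
      simp [hr₁, hr₃, hr₄, e₅ r hr₁ hr₂ hr₃ hr₄]
    · simp only [List.length_cons, add_mul, one_mul]
      have := hg.1
      omega

end Cmd

end SubgroupDiscovery

namespace SubgroupDiscovery

open Computability Turing Function Cmd

/-! ### The exhaustive search as a program -/

instance : DecidableEq Sym := fun a b => match a, b with
  | .bit x, .bit y => decidable_of_iff (x = y) (by simp)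
  | .tick, .tick | .sep, .sep | .negInf, .negInf | .posInf, .posInf => .isTrue rfl
  | .bit _, .tick | .bit _, .sep | .bit _, .negInf | .bit _, .posInf
  | .tick, .bit _ | .tick, .sep | .tick, .negInf | .tick, .posInf
  | .sep, .bit _ | .sep, .tick | .sep, .negInf | .sep, .posInf
  | .negInf, .bit _ | .negInf, .tick | .negInf, .sep | .negInf, .posInf
  | .posInf, .bit _ | .posInf, .tick | .posInf, .sep | .posInf, .negInf =>
    .isFalse (by simp)

instance : Fintype Sym :=
  ⟨{.bit true, .bit false, .tick, .sep, .negInf, .posInf}, fun a => by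
    rcases a with (_ | _) | _ | _ | _ | _ <;> simp⟩

instance : Inhabited Sym := ⟨.tick⟩

def Sym.isSep : Sym → Bool
  | .sep => true
  | _ => false

def Sym.isTick : Sym → Bool
  | .tick => true
  | _ => false

/-- The registers of the search program. -/
inductive Reg : Type
  | inp | budget | features | data | tmp | vals | vals' | valsDone | valsDone' | lower | upper
  | pairs | pairsDone | pair | work | depth | left | path | query | qual | answer | best | bestQual
  | theta
  deriving DecidableEq

instance : Fintype Reg :=
  ⟨{.inp, .budget, .features, .data, .tmp, .vals, .vals', .valsDone, .valsDone', .lower, .upper,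
    .pairs, .pairsDone, .pair, .work, .depth, .left, .path, .query, .qual, .answer, .best,
    .bestQual, .theta}, fun r => by cases r <;> simp⟩

/-- The two procedures: evaluation of the quality, and comparison of named numbers. -/
inductive Proc : Type
  | quality | compare
  deriving DecidableEq

instance : Fintype Proc := ⟨{.quality, .compare}, fun r => by cases r <;> simp⟩

abbrev Prog : Type := Cmd Reg Sym Proc

/-- The name of a bound, without its end mark. -/
def boundBody : Bound → List Sym
  | .negInf => [Sym.negInf]
  | .posInf => [Sym.posInf]
  | .num w => w.map Sym.bit

theorem encBound_eq (b : Bound) : encBound b = boundBody b ++ [Sym.sep] := by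
  cases b <;> rfl

theorem isSep_boundBody (b : Bound) : ∀ a ∈ boundBody b, a.isSep = false := by
  rcases b with _ | _ | w
  · simp [boundBody, Sym.isSep]
  · simp [boundBody, Sym.isSep]
  · intro a ha
    obtain ⟨b, _, rfl⟩ := List.mem_map.1 ha
    rfl

theorem isTick_encBound (b : Bound) : ∀ a ∈ encBound b, a.isTick = false := by
  rcases b with _ | _ | w
  · simp [encBound, Sym.isTick]
  · simp [encBound, Sym.isTick]
  · intro a ha
    rcases List.mem_append.1 ha with h | h
    · obtain ⟨b, _, rfl⟩ := List.mem_map.1 h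
      rfl
    · rw [List.mem_singleton.1 h]; rfl

/-- The bounds of one feature. -/
abbrev Range : Type := Bound × Bound

/-- The bounds that exclude no data object. -/
def fullRange : Range := (.negInf, .posInf)

def encRange (g : Range) : List Sym := encBound g.1 ++ encBound g.2

def encRanges (p : List Range) : List Sym := p.flatMap encRange

theorem isTick_encRange (g : Range) : ∀ a ∈ encRange g, a.isTick = false := by
  intro a ha
  rcases List.mem_append.1 ha with h | h
  · exact isTick_encBound _ a h
  · exact isTick_encBound _ a h

theorem isTick_encRanges (p : List Range) : ∀ a ∈ encRanges p, a.isTick = false := by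
  intro a ha
  obtain ⟨g, _, h⟩ := List.mem_flatMap.1 ha
  exact isTick_encRange g a h

open Reg

/-- Push a partial description, the number of features that it lacks, and the number of features
that may still be selected. -/
def pushNode (front : Prog) : Prog :=
  seq (push work .tick) <| seq (copyRev tmp path work) <| seq front <| seq (push work .sep) <|
    seq (copy tmp left work) <| seq (push work .sep) (copy tmp depth work)

/-- Replace a partial description by its extensions by one feature. -/
def expand : Prog :=
  seq (moveUntil Sym.isSep work depth) <| seq (moveUntil Sym.isSep work left) <|
    seq (moveUntil Sym.isTick work path) <|
    seq (pushNode (pushAll work [.sep, .posInf, .sep, .negInf])) <|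
    seq (pop left fun o => o.elim skip fun _ =>
      forEach Sym.isTick .tick pairs pair pairsDone
        (seq (pushNode (copyRev tmp pair work)) (clear pair))) <|
    seq (clear depth) <| seq (clear left) (clear path)

/-- Compute a name of the quality of the description in `path`. -/
def evaluate : Prog :=
  seq (copy tmp data query) <| seq (copy tmp path query) (call .quality query qual)

/-- Compare the numbers with names in `x` and `y`. -/
def compareNames (x y : Reg) : Prog :=
  seq (copy tmp x query) <| seq (push query .sep) <| seq (copy tmp y query) <|
    seq (push query .sep) (call .compare query answer)

/-- Keep the description in `path`, and its quality. -/
def keepPath : Prog := seq (copy tmp path best) (copy tmp qual bestQual)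

/-- Compare a complete description with the best one so far. -/
def visitLeaf : Prog :=
  seq (moveUntil Sym.isSep work left) <| seq (clear left) <|
    seq (moveUntil Sym.isTick work path) <| seq evaluate <| seq (compareNames bestQual qual) <|
    seq (pop answer fun o => match o with
      | some (.bit true) => seq (clear best) (seq (clear bestQual) keepPath)
      | _ => skip) <|
    seq (clear path) (clear qual)

/-- A node starts with the unary number of missing features: a tick means that some are missing, a
separator that the description is complete. -/
def searchStep : Prog :=
  pop work fun o => match o with
    | some .tick => expand
    | _ => visitLeaf

def searchLoop : Prog := loop work Option.isSome searchStep

/-! ### Stores as records, and the expansion of a node -/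

/-- The contents of the registers. -/
structure Store : Type where
  inp : List Sym := []
  budget : List Sym := []
  features : List Sym := []
  data : List Sym := []
  tmp : List Sym := []
  vals : List Sym := []
  vals' : List Sym := []
  valsDone : List Sym := []
  valsDone' : List Sym := []
  lower : List Sym := []
  upper : List Sym := []
  pairs : List Sym := []
  pairsDone : List Sym := []
  pair : List Sym := []
  work : List Sym := []
  depth : List Sym := []
  left : List Sym := []
  path : List Sym := []
  query : List Sym := []
  qual : List Sym := []
  answer : List Sym := []
  best : List Sym := []
  bestQual : List Sym := []
  theta : List Sym := []

/-- With stores as records, an equation between stores is checked register by register, by cases and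
`simp`. -/
def Store.get (σ : Store) : Reg → List Sym
  | .inp => σ.inp
  | .budget => σ.budget
  | .features => σ.features
  | .data => σ.data
  | .tmp => σ.tmp
  | .vals => σ.vals
  | .vals' => σ.vals'
  | .valsDone => σ.valsDone
  | .valsDone' => σ.valsDone'
  | .lower => σ.lower
  | .upper => σ.upper
  | .pairs => σ.pairs
  | .pairsDone => σ.pairsDone
  | .pair => σ.pair
  | .work => σ.work
  | .depth => σ.depth
  | .left => σ.left
  | .path => σ.path
  | .query => σ.query
  | .qual => σ.qual
  | .answer => σ.answer
  | .best => σ.best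
  | .bestQual => σ.bestQual
  | .theta => σ.theta

/-- Here `r` features are missing, `b` may still be selected, and `p` holds the ranges fixed so far.
The closing tick is a safe end mark, as it does not occur in encoded ranges, whereas separators do.
-/
def encNode (r b : ℕ) (p : List Range) : List Sym :=
  List.replicate r Sym.tick ++ Sym.sep :: (List.replicate b Sym.tick ++
    Sym.sep :: (encRanges p ++ [Sym.tick]))

def encPairs (gs : List Range) : List Sym := gs.flatMap fun g => encRange g ++ [Sym.tick]

variable {O : Proc → List Sym → List Sym → ℕ → Prop}

/-- A stack is filled from the bottom, so the parts of the node are pushed last to first; `front`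
inserts the new range `f` ahead of the old ones. -/
theorem runs_pushNode {front : Prog} {t : ℕ} {f : List Sym}
    (S : Reg → List Sym) (htmp : S tmp = []) (r b : ℕ) (p : List Range)
    (hdepth : S depth = List.replicate r .tick) (hleft : S left = List.replicate b .tick)
    (hpath : S path = (encRanges p).reverse)
    (hfront : ∀ S' : Reg → List Sym, (∀ r, r ≠ work → S' r = S r) →
      Runs O front S' (update S' work (f ++ S' work)) t) :
    Runs O (pushNode front) S (update S work
      (List.replicate r Sym.tick ++ Sym.sep :: (List.replicate b Sym.tick ++
        Sym.sep :: (f ++ (encRanges p ++ [Sym.tick]))) ++ S work))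
      (t + 7 * (encRanges p).length + 7 * b + 7 * r + 9) := by
  have h₁ := Runs.push (O := O) work .tick S
  have h₂ := runs_copyRev (O := O) (tmp := tmp) (src := path) (dst := work) (by simp) (by simp)
    (by simp) (update S work (.tick :: S work)) (by simp [htmp])
  refine (h₁.seq (h₂.seq ((hfront _ (fun r hr => by simp [hr])).seq ((Runs.push _ _ _).seq
    ((runs_copy (by simp) (by simp) (by simp) _ (by simp [htmp])).seq ((Runs.push _ _ _).seq
    (runs_copy (by simp) (by simp) (by simp) _ (by simp [htmp])))))))).of_eq ?_ ?_
  · simp [hdepth, hleft, hpath]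
  · simp [hdepth, hleft, hpath]
    omega

/-- The children of a node, as pushed by `expand`. -/
def encChildren (gs : List Range) (r b : ℕ) (p : List Range) : List Sym :=
  (if b = 0 then [] else gs.reverse.flatMap fun g => encNode r (b - 1) (g :: p)) ++
    encNode r b (fullRange :: p)

/-- The contents of the registers during the search. -/
def nodeStore (D θ : List Sym) (gs : List Range) (s q W d l p v a : List Sym) : Store where
  data := D
  theta := θ
  pairs := encPairs gs
  best := s
  bestQual := q
  work := W
  depth := d
  left := l
  path := p
  qual := v
  answer := a

/-- The contents of the registers between two steps of the search. -/
abbrev searchStore (D θ : List Sym) (gs : List Range) (s q W : List Sym) : Store :=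
  nodeStore D θ gs s q W [] [] [] [] []

theorem isSep_replicate_tick (n : ℕ) : ∀ a ∈ List.replicate n Sym.tick, a.isSep = false := by
  intro a ha; rw [List.eq_of_mem_replicate ha]; rfl

theorem runs_pushChild {g : Range} (S : Reg → List Sym) (htmp : S tmp = []) (r b : ℕ)
    (p : List Range) (hdepth : S depth = List.replicate r .tick)
    (hleft : S left = List.replicate b .tick) (hpath : S path = (encRanges p).reverse)
    (hpair : S pair = (encRange g).reverse) :
    Runs O (seq (pushNode (copyRev tmp pair work)) (clear pair)) S
      (update (update S work (encNode r b (g :: p) ++ S work)) pair [])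
      (10 * (encRange g).length + 7 * (encRanges p).length + 7 * b + 7 * r + 12) := by
  refine ((runs_pushNode (f := encRange g) (t := 7 * (encRange g).length + 2) S htmp r b p hdepth
    hleft hpath fun S' hS' => (runs_copyRev (by simp) (by simp) (by simp) S'
      (by rw [hS' _ (by simp), htmp])).of_eq (by rw [hS' pair (by simp), hpair]; simp)
      (by rw [hS' pair (by simp), hpair]; simp)).seq (runs_clear _ _)).of_eq ?_ ?_
  · simp [encNode, encRanges]
  · simp [hpair]; omega

theorem runs_pushFull (S : Reg → List Sym) (htmp : S tmp = []) (r b : ℕ)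
    (p : List Range) (hdepth : S depth = List.replicate r .tick)
    (hleft : S left = List.replicate b .tick) (hpath : S path = (encRanges p).reverse) :
    Runs O (pushNode (pushAll work [.sep, .posInf, .sep, .negInf])) S
      (update S work (encNode r b (fullRange :: p) ++ S work))
      (7 * (encRanges p).length + 7 * b + 7 * r + 14) := by
  refine (runs_pushNode (f := encRange fullRange) S htmp r b p hdepth hleft hpath fun S' hS' =>
    runs_pushAll _ _ S').of_eq ?_ ?_
  · simp [encNode, encRanges]
  · simp; omega

theorem runs_pushChildren {gs : List Range} {Z : ℕ} (hgs : ∀ g ∈ gs, (encRange g).length ≤ Z)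
    (D θ s q W v a : List Sym) (r b : ℕ) (p : List Range) (hr : r ≤ Z) (hb : b ≤ Z)
    (hp : (encRanges p).length ≤ Z) :
    Runs O (forEach Sym.isTick .tick pairs pair pairsDone
        (seq (pushNode (copyRev tmp pair work)) (clear pair)))
      (nodeStore D θ gs s q W (.replicate r .tick) (.replicate b .tick)
        (encRanges p).reverse v a).get
      (nodeStore D θ gs s q (gs.reverse.flatMap (fun g => encNode r b (g :: p)) ++ W)
        (.replicate r .tick) (.replicate b .tick) (encRanges p).reverse v a).get
      (gs.length * (50 * Z + 30) + 2) := by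
  refine (runs_forEach (x := work) (gs := gs.map encRange) (L := Z) (t := 31 * Z + 12)
    (f := fun g => (List.replicate r Sym.tick ++ Sym.sep :: (List.replicate b Sym.tick ++
      Sym.sep :: (g ++ encRanges p ++ [Sym.tick])))) rfl (by simp) (by simp) (by simp) (by simp)
      (by simp) (by simp) ?_ ?_ rfl rfl ?_).of_eq ?_ ?_
  · intro g hg
    obtain ⟨g, hg', rfl⟩ := List.mem_map.1 hg
    exact ⟨hgs g hg', isTick_encRange g⟩
  · simp [Store.get, nodeStore, encPairs, List.flatMap_map]
  · intro g hg S' hS' hcur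
    obtain ⟨g, hg', rfl⟩ := List.mem_map.1 hg
    refine (runs_pushChild S' ?_ r b p ?_ ?_ ?_ hcur).of_eq ?_ ?_
    · rw [hS' _ (by simp) (by simp) (by simp) (by simp)]; rfl
    · rw [hS' _ (by simp) (by simp) (by simp) (by simp)]; rfl
    · rw [hS' _ (by simp) (by simp) (by simp) (by simp)]; rfl
    · rw [hS' _ (by simp) (by simp) (by simp) (by simp)]; rfl
    · simp [encNode, encRanges]
    · have := hgs g hg'
      omega
  · funext r; cases r <;> simp [Store.get, nodeStore, encNode, encRanges, ← List.map_reverse,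
      List.flatMap_map]
  · simp only [List.length_map]
    gcongr ?_ + 2
    exact Nat.mul_le_mul_left _ (by omega)

/-- `searchStep` has already removed one tick of the parent, so `r` is the number of features that
its children lack. -/
theorem runs_expand {gs : List Range} {Z : ℕ} (hgs : ∀ g ∈ gs, (encRange g).length ≤ Z)
    (D θ s q W : List Sym) (r b : ℕ) (p : List Range) (hr : r ≤ Z) (hb : b ≤ Z)
    (hp : (encRanges p).length ≤ Z) :
    Runs O expand (searchStore D θ gs s q (encNode r b p ++ W)).get
      (searchStore D θ gs s q (encChildren gs r b p ++ W)).get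
      ((gs.length + 1) * (60 * Z + 60)) := by
  have h₁ : Runs O (moveUntil Sym.isSep work depth)
      (searchStore D θ gs s q (encNode r b p ++ W)).get
      (nodeStore D θ gs s q (List.replicate b Sym.tick ++ Sym.sep :: (encRanges p ++ [Sym.tick]) ++ W)
        (.replicate r .tick) [] [] [] []).get (3 * Z + 3) :=
    (runs_moveUntil (by simp) _ (l := List.replicate r .tick) (e := .sep)
      (by simp [Store.get, nodeStore, encNode]; rfl) (isSep_replicate_tick r) rfl).of_eq
      (by funext r; cases r <;> simp [Store.get, nodeStore]) (by simp; omega)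
  have h₂ : Runs O (moveUntil Sym.isSep work left)
      (nodeStore D θ gs s q (List.replicate b Sym.tick ++ Sym.sep :: (encRanges p ++ [Sym.tick]) ++ W)
        (.replicate r .tick) [] [] [] []).get
      (nodeStore D θ gs s q (encRanges p ++ [Sym.tick] ++ W)
        (.replicate r .tick) (.replicate b .tick) [] [] []).get (3 * Z + 3) :=
    (runs_moveUntil (by simp) _ (l := List.replicate b .tick) (e := .sep)
      (by simp [Store.get, nodeStore]; rfl) (isSep_replicate_tick b) rfl).of_eq
      (by funext r; cases r <;> simp [Store.get, nodeStore]) (by simp; omega)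
  have h₃ : Runs O (moveUntil Sym.isTick work path)
      (nodeStore D θ gs s q (encRanges p ++ [Sym.tick] ++ W)
        (.replicate r .tick) (.replicate b .tick) [] [] []).get
      (nodeStore D θ gs s q W
        (.replicate r .tick) (.replicate b .tick) (encRanges p).reverse [] []).get (3 * Z + 3) :=
    (runs_moveUntil (by simp) _ (l := encRanges p) (e := .tick)
      (by simp [Store.get, nodeStore]; rfl) (isTick_encRanges p) rfl).of_eq
      (by funext r; cases r <;> simp [Store.get, nodeStore]) (by omega)
  have h₄ : Runs O (pushNode (pushAll work [.sep, .posInf, .sep, .negInf]))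
      (nodeStore D θ gs s q W
        (.replicate r .tick) (.replicate b .tick) (encRanges p).reverse [] []).get
      (nodeStore D θ gs s q (encNode r b (fullRange :: p) ++ W)
        (.replicate r .tick) (.replicate b .tick) (encRanges p).reverse [] []).get (21 * Z + 14) :=
    (runs_pushFull (Store.get _) rfl r b p rfl rfl rfl).of_eq
      (by funext r; cases r <;> simp [Store.get, nodeStore]) (by omega)
  have h₅ : Runs O (pop left fun o => o.elim skip fun _ =>
      forEach Sym.isTick .tick pairs pair pairsDone
        (seq (pushNode (copyRev tmp pair work)) (clear pair)))
      (nodeStore D θ gs s q (encNode r b (fullRange :: p) ++ W)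
        (.replicate r .tick) (.replicate b .tick) (encRanges p).reverse [] []).get
      (nodeStore D θ gs s q (encChildren gs r b p ++ W)
        (.replicate r .tick) (.replicate (b - 1) .tick) (encRanges p).reverse [] []).get
      (gs.length * (50 * Z + 30) + 3) := by
    -- Without budget the pop finds `left` empty and only the child with the full range remains.
    -- Otherwise the pop pays for one selected feature, and all ranges in `gs` are tried.
    rcases b with _ | b
    · refine (Runs.pop (.skip _)).of_eq ?_ (by omega)
      funext r; cases r <;> simp [Store.get, nodeStore, encChildren]
    · have h := runs_pushChildren (O := O) hgs D θ s q (encNode r (b + 1) (fullRange :: p) ++ W)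
        [] [] r b p hr (by omega) hp
      exact Runs.pop (h.congr (by funext r; cases r <;> simp [Store.get, nodeStore])
        (by simp [encChildren]) le_rfl)
  have h₆ : Runs O (seq (clear depth) (seq (clear left) (clear path)))
      (nodeStore D θ gs s q (encChildren gs r b p ++ W)
        (.replicate r .tick) (.replicate (b - 1) .tick) (encRanges p).reverse [] []).get
      (searchStore D θ gs s q (encChildren gs r b p ++ W)).get (9 * Z + 3) :=
    ((runs_clear _ _).seq ((runs_clear _ _).seq (runs_clear _ _))).of_eq
      (by funext r; cases r <;> simp [Store.get, nodeStore])
      (by simp [Store.get, nodeStore]; omega)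
  refine (h₁.seq (h₂.seq (h₃.seq (h₄.seq (h₅.seq h₆))))).mono ?_
  ring_nf
  omega

/-! ### Leaves of the search -/

section Search

variable {D θ : List Sym} {gs : List Range} {n Z TQ TC : ℕ} {qf : List Range → List Bool}
  {le : List Bool → List Bool → Bool}

/-- Descriptions that consist of the full range and ranges in `gs`. -/
def Ranges (gs : List Range) (p : List Range) : Prop := ∀ g ∈ p, g = fullRange ∨ g ∈ gs

/-- The procedures answer correctly and in time on the queries of the search, and all words of the
search have length at most `Z`. -/
structure Correct (O : Proc → List Sym → List Sym → ℕ → Prop) (D : List Sym) (gs : List Range)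
    (n Z TQ TC : ℕ) (qf : List Range → List Bool) (le : List Bool → List Bool → Bool) : Prop where
  quality : ∀ p, p.length = n → Ranges gs p →
    O .quality (D ++ encRanges p) ((qf p).map Sym.bit) TQ
  compare : ∀ w w', w.length ≤ Z → w'.length ≤ Z →
    O .compare (encWords (w, w')) [Sym.bit (le w w')] TC
  length_data : D.length ≤ Z
  length_range : ∀ g ∈ gs, (encRange g).length ≤ Z
  length_ranges : ∀ p, p.length ≤ n → Ranges gs p → (encRanges p).length ≤ Z
  length_quality : ∀ p, p.length = n → Ranges gs p → (qf p).length ≤ Z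

/-- The name of the quality of a description, as stored in the registers. -/
def qualReg (qf : List Range → List Bool) (p : List Range) : List Sym :=
  ((qf p).map Sym.bit).reverse

/-- Dataset and description are stored reversed: copied on top of each other they form the reversed
query, and the call reverses it once more. -/
theorem runs_evaluate (h : Correct O D gs n Z TQ TC qf le) (s q W : List Sym) (p : List Range)
    (hp : p.length = n) (hgs : Ranges gs p) :
    Runs O evaluate (nodeStore D.reverse θ gs s q W [] [] (encRanges p).reverse [] []).get
      (nodeStore D.reverse θ gs s q W [] [] (encRanges p).reverse (qualReg qf p) []).get
      (TQ + 17 * Z + 6) := by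
  have hc := Runs.call (O := O) (src := query) (dst := qual)
    (S := Store.get { nodeStore D.reverse θ gs s q W [] [] (encRanges p).reverse [] [] with
      query := (D ++ encRanges p).reverse })
    (by simpa [Store.get] using h.quality p hp hgs)
  refine ((runs_copy (by simp) (by simp) (by simp) _ rfl).seq
    ((runs_copy (by simp) (by simp) (by simp) _ (by simp [Store.get, nodeStore])).seq
      (hc.congr ?_ ?_ le_rfl))).mono ?_
  · funext r; cases r <;> simp [Store.get, nodeStore]
  · funext r; cases r <;> simp [Store.get, nodeStore, qualReg]
  · have h₁ := h.length_data
    have h₂ := h.length_ranges p hp.le hgs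
    have h₃ := h.length_quality p hp hgs
    simp [Store.get, nodeStore]
    omega

theorem runs_compareNames (h : Correct O D gs n Z TQ TC qf le) {x y : Reg} {w w' : List Bool}
    (hw : w.length ≤ Z) (hw' : w'.length ≤ Z) (S : Reg → List Sym)
    (hx : S x = (w.map Sym.bit).reverse) (hy : S y = (w'.map Sym.bit).reverse)
    (hne : x ≠ tmp ∧ x ≠ query) (hne' : y ≠ tmp ∧ y ≠ query)
    (htmp : S tmp = []) (hquery : S query = []) (hans : S answer = []) :
    Runs O (compareNames x y) S (update S answer [Sym.bit (le w w')]) (TC + 16 * Z + 11) := by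
  have hc := Runs.call (O := O) (src := query) (dst := answer)
    (S := update S query (encWords (w, w')).reverse)
    (by simpa using h.compare w w' hw hw')
  refine ((runs_copy hne.1.symm (by simp) hne.2 _ htmp).seq ((Runs.push _ _ _).seq
    ((runs_copy hne'.1.symm (by simp) hne'.2 _ (by simp [htmp])).seq
    ((Runs.push _ _ _).seq (hc.congr ?_ ?_ le_rfl))))).mono ?_
  · simp [encWords, encWord, hne'.2, hx, hy, hquery]
  · funext r
    by_cases h₁ : r = answer
    · subst h₁; simp [hans]
    by_cases h₂ : r = query
    · subst h₂; simp [hquery]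
    simp [h₁, h₂]
  · simp [hne'.2, hx, hy, encWords, encWord]
    omega

/-- The better one of two descriptions. -/
def better (qf : List Range → List Bool) (le : List Bool → List Bool → Bool)
    (s p : List Range) : List Range :=
  if le (qf s) (qf p) then p else s

theorem runs_keepPath (D θ : List Sym) (gs : List Range) (p : List Range) (W : List Sym)
    (hZ : (encRanges p).length ≤ Z) (hZ' : (qf p).length ≤ Z) :
    Runs O keepPath
      (nodeStore D θ gs [] [] W [] [] (encRanges p).reverse (qualReg qf p) []).get
      (nodeStore D θ gs (encRanges p).reverse (qualReg qf p) W [] [] (encRanges p).reverse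
        (qualReg qf p) []).get (14 * Z + 4) := by
  refine ((runs_copy (by simp) (by simp) (by simp) _ rfl).seq
    (runs_copy (by simp) (by simp) (by simp) _ (by simp [Store.get, nodeStore]))).of_eq ?_ ?_
  · funext r; cases r <;> simp [Store.get, nodeStore]
  · simp [Store.get, nodeStore, qualReg]; omega

/-- The separator in front of the unused budget was popped by `searchStep`, so the node starts with
that budget, which is discarded. -/
theorem runs_visitLeaf (h : Correct O D gs n Z TQ TC qf le) (W : List Sym) (b : ℕ) (hb : b ≤ Z)
    (s p : List Range) (hs : s.length = n) (hsg : Ranges gs s) (hp : p.length = n)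
    (hpg : Ranges gs p) :
    Runs O visitLeaf
      (searchStore D.reverse θ gs (encRanges s).reverse (qualReg qf s)
        (List.replicate b Sym.tick ++ Sym.sep :: (encRanges p ++ [Sym.tick]) ++ W)).get
      (searchStore D.reverse θ gs (encRanges (better qf le s p)).reverse
        (qualReg qf (better qf le s p)) W).get
      (TQ + TC + 80 * Z + 80) := by
  have hZs := h.length_ranges s hs.le hsg
  have hZp := h.length_ranges p hp.le hpg
  have hZqs := h.length_quality s hs hsg
  have hZqp := h.length_quality p hp hpg
  have h₁ : Runs O (moveUntil Sym.isSep work left)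
      (searchStore D.reverse θ gs (encRanges s).reverse (qualReg qf s)
        (List.replicate b Sym.tick ++ Sym.sep :: (encRanges p ++ [Sym.tick]) ++ W)).get
      (nodeStore D.reverse θ gs (encRanges s).reverse (qualReg qf s)
        (encRanges p ++ [Sym.tick] ++ W) [] (.replicate b .tick) [] [] []).get (3 * Z + 3) :=
    (runs_moveUntil (by simp) _ (l := List.replicate b .tick) (e := .sep)
      (by simp [Store.get, nodeStore]; rfl) (isSep_replicate_tick b) rfl).of_eq
      (by funext r; cases r <;> simp [Store.get, nodeStore]) (by simp; omega)
  have h₂ : Runs O (clear left) _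
      (searchStore D.reverse θ gs (encRanges s).reverse (qualReg qf s)
        (encRanges p ++ [Sym.tick] ++ W)).get (3 * Z + 1) :=
    (runs_clear left (nodeStore D.reverse θ gs (encRanges s).reverse (qualReg qf s)
        (encRanges p ++ [Sym.tick] ++ W) [] (.replicate b .tick) [] [] []).get).of_eq
      (by funext r; cases r <;> simp [Store.get, nodeStore])
      (by simp [Store.get, nodeStore]; omega)
  have h₃ : Runs O (moveUntil Sym.isTick work path)
      (searchStore D.reverse θ gs (encRanges s).reverse (qualReg qf s)
        (encRanges p ++ [Sym.tick] ++ W)).get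
      (nodeStore D.reverse θ gs (encRanges s).reverse (qualReg qf s) W
        [] [] (encRanges p).reverse [] []).get (3 * Z + 3) :=
    (runs_moveUntil (by simp) _ (l := encRanges p) (e := .tick)
      (by simp [Store.get, nodeStore]; rfl) (isTick_encRanges p) rfl).of_eq
      (by funext r; cases r <;> simp [Store.get, nodeStore]) (by omega)
  have h₄ := runs_evaluate (θ := θ) h (encRanges s).reverse (qualReg qf s) W p hp hpg
  have h₅ : Runs O (compareNames bestQual qual)
      (nodeStore D.reverse θ gs (encRanges s).reverse (qualReg qf s) W
        [] [] (encRanges p).reverse (qualReg qf p) []).get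
      (nodeStore D.reverse θ gs (encRanges s).reverse (qualReg qf s) W
        [] [] (encRanges p).reverse (qualReg qf p) [.bit (le (qf s) (qf p))]).get
      (TC + 16 * Z + 11) :=
    (runs_compareNames h hZqs hZqp _ rfl rfl (by simp) (by simp) rfl rfl rfl).of_eq
      (by funext r; cases r <;> simp [Store.get, nodeStore]) le_rfl
  have h₆ : Runs O (pop answer fun o => match o with
      | some (.bit true) => seq (clear best) (seq (clear bestQual) keepPath)
      | _ => skip)
      (nodeStore D.reverse θ gs (encRanges s).reverse (qualReg qf s) W
        [] [] (encRanges p).reverse (qualReg qf p) [.bit (le (qf s) (qf p))]).get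
      (nodeStore D.reverse θ gs (encRanges (better qf le s p)).reverse
        (qualReg qf (better qf le s p)) W [] [] (encRanges p).reverse (qualReg qf p) []).get
      (20 * Z + 7) := by
    unfold better
    cases le (qf s) (qf p)
    · refine (Runs.pop (.skip _)).of_eq ?_ (by omega)
      funext r; cases r <;> simp [Store.get, nodeStore]
    · refine (Runs.pop (t := 20 * Z + 6) (((runs_clear best _).seq ((runs_clear bestQual _).seq
        ((runs_keepPath (Z := Z) (qf := qf) D.reverse θ gs p W hZp hZqp).congr
          ?_ rfl le_rfl))).mono ?_)).of_eq ?_ le_rfl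
      · funext r; cases r <;> simp [Store.get, nodeStore]
      · simp [Store.get, nodeStore, qualReg]; omega
      · simp
  have h₇ : Runs O (seq (clear path) (clear qual))
      (nodeStore D.reverse θ gs (encRanges (better qf le s p)).reverse
        (qualReg qf (better qf le s p)) W [] [] (encRanges p).reverse (qualReg qf p) []).get
      (searchStore D.reverse θ gs (encRanges (better qf le s p)).reverse
        (qualReg qf (better qf le s p)) W).get (6 * Z + 2) :=
    ((runs_clear _ _).seq (runs_clear _ _)).of_eq
      (by funext r; cases r <;> simp [Store.get, nodeStore])
      (by simp [Store.get, nodeStore, qualReg]; omega)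
  exact (h₁.seq (h₂.seq (h₃.seq (h₄.seq (h₅.seq (h₆.seq h₇)))))).mono (by omega)

end Search

end SubgroupDiscovery

namespace SubgroupDiscovery

open Computability Turing Function Cmd
open Reg

/-! ### The search tree: leaves, size and traversal -/

section Search

variable {O : Proc → List Sym → List Sym → ℕ → Prop}
variable {D θ : List Sym} {gs : List Range} {n Z TQ TC : ℕ} {qf : List Range → List Bool}
  {le : List Bool → List Bool → Bool}

/-- The complete descriptions below a node of the search tree, for a partial description `p` that
lacks `r` features, at most `b` of which may be selected. -/
def leaves (gs : List Range) : ℕ → ℕ → List Range → List (List Range)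
  | 0, _, p => [p]
  | r + 1, 0, p => leaves gs r 0 (fullRange :: p)
  | r + 1, b + 1, p => (gs.reverse.flatMap fun g => leaves gs r b (g :: p)) ++
      leaves gs r (b + 1) (fullRange :: p)

/-- The number of nodes of the search tree. -/
def nodeCount (G : ℕ) : ℕ → ℕ → ℕ
  | 0, _ => 1
  | r + 1, 0 => nodeCount G r 0 + 1
  | r + 1, b + 1 => G * nodeCount G r b + nodeCount G r (b + 1) + 1

/-- The bound fits the recursion because G * (1 + r G)^b + (1 + r G)^(b+1) = (1 + r G)^b * (1 +
(r+1) G). The node itself is paid for by the growth of the factor r + 1. -/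
theorem nodeCount_le (G r b : ℕ) : nodeCount G r b ≤ (r + 1) * (1 + r * G) ^ b := by
  induction r generalizing b with
  | zero => simp [nodeCount]
  | succ r ih =>
    rcases b with _ | b
    · have := ih 0
      simp [nodeCount] at this ⊢
      exact this
    · have h₁ := ih b
      have h₂ := ih (b + 1)
      have h₃ : (1 + r * G) ^ b ≤ (1 + (r + 1) * G) ^ b :=
        Nat.pow_le_pow_left (by nlinarith) b
      have h₄ : 1 ≤ (1 + (r + 1) * G) ^ (b + 1) := Nat.one_le_pow _ _ (by omega)
      calc nodeCount G (r + 1) (b + 1)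
          ≤ G * ((r + 1) * (1 + r * G) ^ b) + (r + 1) * (1 + r * G) ^ (b + 1) + 1 := by
            simp only [nodeCount]
            gcongr
        _ = (r + 1) * ((1 + r * G) ^ b * (1 + (r + 1) * G)) + 1 := by ring
        _ ≤ (r + 1) * ((1 + (r + 1) * G) ^ b * (1 + (r + 1) * G)) + 1 := by gcongr
        _ ≤ (r + 1 + 1) * (1 + (r + 1) * G) ^ (b + 1) := by
            rw [← pow_succ]
            nlinarith

theorem Ranges.cons {g : Range} {p : List Range} (hg : g = fullRange ∨ g ∈ gs)
    (hp : Ranges gs p) : Ranges gs (g :: p) := by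
  intro x hx
  rcases List.mem_cons.1 hx with rfl | hx
  · exact hg
  · exact hp x hx

theorem mem_leaves_ranges {r b : ℕ} {p l : List Range} (hp : Ranges gs p)
    (hl : l ∈ leaves gs r b p) : Ranges gs l ∧ l.length = p.length + r := by
  induction r generalizing b p with
  | zero =>
    simp only [leaves, List.mem_singleton] at hl
    subst hl
    exact ⟨hp, rfl⟩
  | succ r ih =>
    have hfull : ∀ b, l ∈ leaves gs r b (fullRange :: p) →
        Ranges gs l ∧ l.length = p.length + (r + 1) := by
      intro b hl
      have h := ih (hp.cons (.inl rfl)) hl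
      simp only [List.length_cons] at h
      exact ⟨h.1, by omega⟩
    rcases b with _ | b
    · exact hfull 0 hl
    · rw [leaves, List.mem_append] at hl
      rcases hl with hl | hl
      · obtain ⟨g, hg, hl⟩ := List.mem_flatMap.1 hl
        have h := ih (hp.cons (.inr (List.mem_reverse.1 hg))) hl
        simp only [List.length_cons] at h
        exact ⟨h.1, by omega⟩
      · exact hfull _ hl

/-- The state of the search when `W` remains to be visited and `s` is the best description. -/
def bestStore (D θ : List Sym) (gs : List Range) (qf : List Range → List Bool)
    (s : List Range) (W : List Sym) : Reg → List Sym :=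
  (searchStore D.reverse θ gs (encRanges s).reverse (qualReg qf s) W).get

theorem foldl_better_ranges {L : List (List Range)} {s : List Range}
    (hs : Ranges gs s ∧ s.length = n) (hL : ∀ p ∈ L, Ranges gs p ∧ p.length = n) :
    Ranges gs (L.foldl (better qf le) s) ∧ (L.foldl (better qf le) s).length = n := by
  induction L generalizing s with
  | nil => exact hs
  | cons p L ih =>
    refine ih ?_ fun p hp => hL p (by simp [hp])
    unfold better
    split_ifs
    · exact hL p (by simp)
    · exact hs

/-- A bound for the time of a step of the search. -/
def stepTime (G Z TQ TC : ℕ) : ℕ := TQ + TC + (G + 1) * (80 * Z + 80) + 2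

theorem bestStore_work (s : List Range) (W : List Sym) : bestStore D θ gs qf s W work = W := rfl

/-- The worklist is a stack, so the whole subtree of its top node is visited before `W`. The
statement is in continuation form: a run from `W`, with the best description updated by the leaves
of the subtree, extends to a run that starts with the node on top. Subtrees then compose without
splitting the loop. -/
theorem runs_searchLoop (h : Correct O D gs n Z TQ TC qf le) (r b : ℕ) (hr : r ≤ Z) (hb : b ≤ Z)
    (p s : List Range) (hp : Ranges gs p) (hpn : p.length + r = n)
    (hs : Ranges gs s ∧ s.length = n) (W : List Sym) (S : Reg → List Sym) (t : ℕ)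
    (hW : Runs O searchLoop (bestStore D θ gs qf ((leaves gs r b p).foldl (better qf le) s) W)
      S t) :
    Runs O searchLoop (bestStore D θ gs qf s (encNode r b p ++ W)) S
      (nodeCount gs.length r b * stepTime gs.length Z TQ TC + t) := by
  induction r generalizing b p s W t with
  | zero =>
    have hleaf := runs_visitLeaf (θ := θ) h W b hb s p hs.2 hs.1 hpn hp
    have hstep : Runs O searchStep (bestStore D θ gs qf s (encNode 0 b p ++ W))
        (bestStore D θ gs qf (better qf le s p) W) (TQ + TC + 80 * Z + 80 + 1) :=
      .pop (hleaf.congr (by funext r; cases r <;> simp [Store.get, nodeStore, bestStore, encNode])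
        rfl le_rfl)
    refine (Runs.loop_step (by simp [bestStore_work, encNode]) hstep hW).mono ?_
    simp only [nodeCount, stepTime]
    nlinarith
  | succ r ih =>
    have hexp := runs_expand (O := O) h.length_range D.reverse θ (encRanges s).reverse
      (qualReg qf s) W r b p (by omega) hb (h.length_ranges p (by omega) hp)
    have hstep : Runs O searchStep (bestStore D θ gs qf s (encNode (r + 1) b p ++ W))
        (bestStore D θ gs qf s (encChildren gs r b p ++ W))
        ((gs.length + 1) * (60 * Z + 60) + 1) :=
      .pop (hexp.congr (by
        funext r; cases r <;> simp [Store.get, nodeStore, bestStore, encNode,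
          List.replicate_succ]) rfl le_rfl)
    have hfull : ∀ (b : ℕ) (s : List Range) (t : ℕ), b ≤ Z → Ranges gs s ∧ s.length = n →
        Runs O searchLoop (bestStore D θ gs qf
          ((leaves gs r b (fullRange :: p)).foldl (better qf le) s) W) S t →
        Runs O searchLoop (bestStore D θ gs qf s (encNode r b (fullRange :: p) ++ W)) S
          (nodeCount gs.length r b * stepTime gs.length Z TQ TC + t) :=
      fun b s t hb hs hW => ih b (by omega) hb _ s (hp.cons (.inl rfl)) (by simp; omega) hs W t hW
    have hT : (gs.length + 1) * (60 * Z + 60) + 1 + 1 ≤ stepTime gs.length Z TQ TC := by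
      unfold stepTime
      have : (gs.length + 1) * (60 * Z + 60) ≤ (gs.length + 1) * (80 * Z + 80) := by
        gcongr <;> omega
      omega
    rcases b with _ | b
    · refine (Runs.loop_step (by simp [bestStore_work, encNode, List.replicate_succ]) hstep
        (hfull 0 s t hb hs hW)).mono ?_
      generalize (gs.length + 1) * (60 * Z + 60) = X at hT ⊢
      simp only [nodeCount, add_mul, one_mul]
      omega
    -- The siblings that spend budget are visited one after another, by induction over a list of
    -- ranges drawn from `gs`; the subtree of the full range serves as their continuation.
    · have key : ∀ (gs' : List Range), (∀ g ∈ gs', g ∈ gs) → ∀ (s : List Range) (W' : List Sym)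
          (t : ℕ), Ranges gs s ∧ s.length = n →
          Runs O searchLoop (bestStore D θ gs qf
            ((gs'.flatMap fun g => leaves gs r b (g :: p)).foldl (better qf le) s) W') S t →
          Runs O searchLoop (bestStore D θ gs qf s
            ((gs'.flatMap fun g => encNode r b (g :: p)) ++ W')) S
            (gs'.length * (nodeCount gs.length r b * stepTime gs.length Z TQ TC) + t) := by
        intro gs'
        induction gs' with
        | nil => intro _ s W' t _ hW'; exact hW'.mono (by simp)
        | cons g gs' ihg =>
          intro hgs' s W' t hs hW'
          rw [List.flatMap_cons, List.foldl_append] at hW'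
          have hg := hgs' g (by simp)
          have h' := ih b (by omega) (by omega) (g :: p) s (hp.cons (.inr hg)) (by simp; omega) hs
            _ _ (ihg (fun g hg => hgs' g (by simp [hg])) _ W' t (foldl_better_ranges hs
              fun l hl => by
                have := mem_leaves_ranges (hp.cons (.inr hg)) hl
                simp only [List.length_cons] at this
                exact ⟨this.1, by omega⟩) hW')
          refine h'.congr (by simp) rfl ?_
          simp only [List.length_cons, add_mul, one_mul]
          omega
      rw [leaves, List.foldl_append] at hW
      have h' := key gs.reverse (fun g hg => List.mem_reverse.1 hg) s
        (encNode r (b + 1) (fullRange :: p) ++ W) _ hs (hfull (b + 1) _ t hb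
          (foldl_better_ranges hs fun l hl => by
            obtain ⟨g, hg, hl⟩ := List.mem_flatMap.1 hl
            have := mem_leaves_ranges (hp.cons (.inr (List.mem_reverse.1 hg))) hl
            simp only [List.length_cons] at this
            exact ⟨this.1, by omega⟩) hW)
      refine (Runs.loop_step (by simp [bestStore_work, encNode, List.replicate_succ]) hstep
        (h'.congr (by simp [encChildren]) rfl le_rfl)).mono ?_
      generalize (gs.length + 1) * (60 * Z + 60) = X at hT ⊢
      simp only [nodeCount, add_mul, one_mul, List.length_reverse, mul_assoc]
      omega

end Search

end SubgroupDiscovery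

namespace SubgroupDiscovery

open Computability Turing Function Cmd
open Reg

/-! ### Reading the instance -/

variable {O : Proc → List Sym → List Sym → ℕ → Prop}

/-- Remove every tick together with the symbol that follows it. -/
def strip : List Sym → List Sym
  | .tick :: _ :: l => strip l
  | [.tick] => []
  | a :: l => a :: strip l
  | [] => []

/-- In the rows of a dataset a tick is always followed by a label, so dropping such pairs leaves the
names of the entries. -/
def stripTicks : Prog :=
  drain inp fun a => match a with
    | .tick => pop inp fun _ => skip
    | a => push vals' a

theorem runs_stripTicks (l : List Sym) (S : Reg → List Sym) (hS : S inp = l) :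
    Runs O stripTicks S (update (update S inp []) vals' ((strip l).reverse ++ S vals'))
      (4 * l.length + 1) := by
  -- All symbols other than a tick are treated alike.
  have hpush : ∀ (a : Sym) (l : List Sym) (S : Reg → List Sym), a ≠ .tick → S inp = a :: l →
      Runs O stripTicks (update (update S inp l) vals' (a :: S vals'))
        (update (update S inp []) vals' ((strip l).reverse ++ a :: S vals')) (4 * l.length + 1) →
      Runs O stripTicks S (update (update S inp []) vals' ((a :: strip l).reverse ++ S vals'))
        (4 * (l.length + 1) + 1) := by
    intro a l S ha hS ih
    refine (Runs.loop_step (t := 2) (by simp [hS]) (.pop ?_) ih).of_eq (by simp) (by omega)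
    have := Runs.push (O := O) vals' a (update S inp l)
    simp only [hS, List.head?_cons, Option.elim_some, List.tail_cons]
    cases a <;> first | exact absurd rfl ha | simpa using this
  induction l using strip.induct generalizing S with
  | case1 a l ih =>
    have h := ih (update S inp l) (by simp)
    refine (Runs.loop_step (t := 3) (by simp [hS]) (.pop ?_) h).of_eq
      (by simp [strip]) (by simp; omega)
    have := Runs.pop (O := O) (r := inp) (next := fun _ => skip)
      (S := update S inp (a :: l)) (.skip _)
    simpa [hS] using this
  | case2 =>
    refine (Runs.loop_step (t := 3) (S' := update S inp []) (by simp [hS]) (.pop ?_)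
      (.loop_exit (by simp))).of_eq (by simp [strip]) (by simp)
    have := Runs.pop (O := O) (r := inp) (next := fun _ => skip)
      (S := update S inp []) (.skip _)
    simpa [hS] using this
  | case3 a l h₁ h₂ ih =>
    have ha : a ≠ .tick := by
      rintro rfl
      rcases l with _ | ⟨b, l⟩
      · exact h₂ rfl rfl
      · exact h₁ b l rfl rfl
    have e : strip (a :: l) = a :: strip l := by
      cases a <;> first | exact absurd rfl ha | rfl
    rw [e]
    refine hpush a l S ha hS ((ih (update (update S inp l) vals' (a :: S vals')) (by simp)).of_eq
      ?_ le_rfl)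
    funext r; by_cases h : r = vals' <;> by_cases h' : r = inp <;> simp [h, h']
  | case4 =>
    refine (Runs.loop_exit (by simp [hS])).of_eq ?_ (by simp)
    have e : update S inp [] = S := by rw [← hS, update_eq_self]
    simp [strip, e]

theorem strip_append {l : List Sym} (hl : ∀ a ∈ l, a ≠ .tick) (l' : List Sym) :
    strip (l ++ l') = l ++ strip l' := by
  induction l with
  | nil => rfl
  | cons a l ih =>
    have ha := hl a (by simp)
    have e : strip (a :: (l ++ l')) = a :: strip (l ++ l') := by
      cases a <;> first | exact absurd rfl ha | rfl
    rw [List.cons_append, e, ih fun a ha => hl a (by simp [ha]), List.cons_append]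

theorem encWord_ne_tick (w : List Bool) : ∀ a ∈ encWord w, a ≠ .tick := by
  intro a ha
  rcases List.mem_append.1 ha with h | h
  · obtain ⟨b, _, rfl⟩ := List.mem_map.1 h
    simp
  · rw [List.mem_singleton.1 h]; simp

/-- The names of the entries of a dataset. -/
def Dataset.words (D : Dataset) : List (List Bool) :=
  (List.finRange D.m).flatMap fun i => (List.finRange D.n).map fun j => D.X i j

def Dataset.rows (D : Dataset) : List Sym :=
  (List.finRange D.m).flatMap fun i =>
    Sym.tick :: Sym.bit (D.y i) :: (List.finRange D.n).flatMap fun j => encWord (D.X i j)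

/-- The end mark of the dataset is read as one more, empty, word. This only adds a superfluous
candidate bound, which does no harm: every bit string names a real number, and bounds outside the
data are admissible. -/
theorem strip_rows (D : Dataset) :
    strip (D.rows ++ [Sym.sep]) = (D.words ++ [[]]).flatMap encWord := by
  unfold Dataset.rows Dataset.words
  generalize List.finRange D.m = L
  induction L with
  | nil => rfl
  | cons i L ih =>
    rw [List.flatMap_cons, List.flatMap_cons, List.append_assoc, List.cons_append,
      List.cons_append, strip, strip_append, ih]
    · simp [List.flatMap_map, List.append_assoc]
    · intro a ha
      obtain ⟨j, _, ha⟩ := List.mem_flatMap.1 ha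
      exact encWord_ne_tick _ a ha

/-- The bounds that the search tries. -/
def Dataset.bounds (D : Dataset) : List Bound :=
  .negInf :: .posInf :: (D.words ++ [[]]).map Bound.num

theorem encBounds_eq (D : Dataset) : D.bounds.flatMap encBound =
    [.negInf, .sep, .posInf, .sep] ++ strip (D.rows ++ [Sym.sep]) := by
  rw [strip_rows]
  simp [Dataset.bounds, List.flatMap_map, encBound]

/-! ### The list of all ranges -/

def pushPair : Prog :=
  seq (push pairs .tick) <| seq (push pairs .sep) <| seq (copyRev tmp upper pairs) <|
    seq (push pairs .sep) <| seq (copyRev tmp lower pairs) (clear upper)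

/-- Two nested loops over two copies of the list of bounds; the range with every lower and every
upper bound is pushed. -/
def makePairs : Prog :=
  forEach Sym.isSep .sep vals lower valsDone <|
    seq (forEach Sym.isSep .sep vals' upper valsDone' pushPair) (clear lower)

/-- All ranges with bounds in a list. -/
def allRanges (L : List Bound) : List Range :=
  L.reverse.flatMap fun a => L.reverse.map fun b => (a, b)

theorem mem_allRanges {L : List Bound} {g : Range} :
    g ∈ allRanges L ↔ g.1 ∈ L ∧ g.2 ∈ L := by
  rcases g with ⟨a, b⟩
  simp [allRanges]

theorem length_allRanges (L : List Bound) : (allRanges L).length = L.length * L.length := by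
  simp [allRanges]

/-- Both loops stack their results, which accounts for the reversals in `allRanges`. -/
theorem runs_makePairs {L : List Bound} {Z : ℕ} (hL : ∀ a ∈ L, (boundBody a).length ≤ Z)
    (S : Reg → List Sym) (hvals : S vals = L.flatMap encBound)
    (hvals' : S vals' = L.flatMap encBound) (htmp : S tmp = []) (hlower : S lower = [])
    (hupper : S upper = []) (hdone : S valsDone = []) (hdone' : S valsDone' = []) :
    Runs O makePairs S (update S pairs (encPairs (allRanges L) ++ S pairs))
      (L.length * (10 * Z + 9 + (L.length * (24 * Z + 17) + 2)) + 2) := by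
  have henc : L.flatMap encBound = (L.map boundBody).flatMap (· ++ [Sym.sep]) := by
    rw [List.flatMap_map]
    exact congrArg (L.flatMap ·) (funext encBound_eq)
  have hgs : ∀ g ∈ L.map boundBody, g.length ≤ Z ∧ ∀ a ∈ g, a.isSep = false := by
    intro g hg
    obtain ⟨a, ha, rfl⟩ := List.mem_map.1 hg
    exact ⟨hL a ha, isSep_boundBody a⟩
  rw [henc] at hvals hvals'
  have hpush : ∀ (u v : List Sym) (S : Reg → List Sym), u.length ≤ Z → v.length ≤ Z →
      S tmp = [] → S lower = u.reverse → S upper = v.reverse →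
      Runs O pushPair S (update (update S pairs ((u ++ Sym.sep :: (v ++ [.sep, .tick])) ++ S pairs))
        upper []) (17 * Z + 9) := by
    intro u v S hu hv htmp hlower hupper
    refine ((Runs.push _ _ _).seq ((Runs.push _ _ _).seq ((runs_copyRev (by simp) (by simp)
      (by simp) _ (by simp [htmp])).seq ((Runs.push _ _ _).seq ((runs_copyRev (by simp) (by simp)
      (by simp) _ (by simp [htmp])).seq (runs_clear _ _)))))).of_eq ?_ ?_
    · simp [hlower, hupper]
    · simp [hlower, hupper]; omega
  have hinner : ∀ (u : List Sym) (S : Reg → List Sym), u.length ≤ Z → S tmp = [] →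
      S lower = u.reverse → S upper = [] → S valsDone' = [] →
      S vals' = (L.map boundBody).flatMap (· ++ [Sym.sep]) →
      Runs O (forEach Sym.isSep .sep vals' upper valsDone' pushPair) S
        (update S pairs (((L.map boundBody).reverse.flatMap fun v =>
          u ++ Sym.sep :: (v ++ [.sep, .tick])) ++ S pairs)) (L.length * (24 * Z + 17) + 2) := by
    intro u S hu htmp hlower hupper hdone' hvals'
    refine (runs_forEach (L := Z) (t := 17 * Z + 9) (f := fun v => u ++ Sym.sep ::
      (v ++ [.sep, .tick])) rfl (by simp) (by simp) (by simp) (by simp) (by simp) (by simp)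
      hgs hvals' hupper hdone' ?_).of_eq rfl ?_
    · intro g hg S' hS' hcur
      refine hpush u g S' hu (hgs g hg).1 ?_ ?_ hcur
      · rw [hS' _ (by simp) (by simp) (by simp) (by simp), htmp]
      · rw [hS' _ (by simp) (by simp) (by simp) (by simp), hlower]
    · rw [List.length_map]
      gcongr ?_ + 2
      exact Nat.mul_le_mul_left _ (by omega)
  refine (runs_forEach (x := pairs) (L := Z) (t := L.length * (24 * Z + 17) + 2 + (3 * Z + 1))
    (f := fun u => (L.map boundBody).reverse.flatMap fun v => u ++ Sym.sep :: (v ++ [.sep, .tick]))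
    rfl (by simp) (by simp) (by simp) (by simp) (by simp) (by simp) hgs hvals hlower hdone
    ?_).of_eq ?_ ?_
  · intro g hg S' hS' hcur
    refine ((hinner g S' (hgs g hg).1 ?_ hcur ?_ ?_ ?_).seq (runs_clear _ _)).of_eq rfl ?_
    · rw [hS' _ (by simp) (by simp) (by simp) (by simp), htmp]
    · rw [hS' _ (by simp) (by simp) (by simp) (by simp), hupper]
    · rw [hS' _ (by simp) (by simp) (by simp) (by simp), hdone']
    · rw [hS' _ (by simp) (by simp) (by simp) (by simp), hvals']
    · have := (hgs g hg).1
      simp [hcur]; omega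
  · congr 2
    simp [encPairs, allRanges, List.flatMap_assoc, List.flatMap_map, ← List.map_reverse,
      encRange, encBound_eq]
  · rw [List.length_map]
    gcongr ?_ + 2
    exact Nat.mul_le_mul_left _ (by omega)

/-! ### The complete search -/

/-- Read the instance and prepare the search. -/
def readInstance : Prog :=
  seq (moveUntil Sym.isSep inp budget) <| seq (seq (dup inp data tmp) (move tmp inp)) <|
    seq (moveUntil Sym.isSep inp features) <| seq stripTicks <|
    seq (seq (move vals' vals) (seq (pushAll vals [.sep, .posInf, .sep, .negInf])
      (copy tmp vals vals'))) <|
    seq makePairs <| seq (seq (clear vals) (clear vals')) <|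
    seq (seq (pushAll work [.tick, .sep]) (seq (move budget work) (seq (push work .sep)
      (copy tmp features work)))) <|
    drain features fun _ => pushAll path [.negInf, .sep, .posInf, .sep]

/-- The contents of the registers while the instance is read. -/
def readStore (θ I B F E V V' P W p : List Sym) : Store where
  theta := θ
  inp := I
  budget := B
  features := F
  data := E
  vals := V
  vals' := V'
  pairs := P
  work := W
  path := p

/-- The parameter `m` counts the full ranges already on `path`, as the induction requires. -/
theorem runs_fullPath (n : ℕ) (S : Reg → List Sym) (hS : S features = List.replicate n .tick)
    (m : ℕ) (hpath : S path = (encRanges (List.replicate m fullRange)).reverse) :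
    Runs O (drain features fun _ => pushAll path [.negInf, .sep, .posInf, .sep]) S
      (update (update S features []) path (encRanges (List.replicate (m + n) fullRange)).reverse)
      (7 * n + 1) := by
  induction n generalizing S m with
  | zero =>
    refine (Runs.loop_exit (by simp [hS])).of_eq ?_ (by simp)
    have e : update S features [] = S := by
      rw [show ([] : List Sym) = S features by simp [hS], update_eq_self]
    rw [e, Nat.add_zero, ← hpath, update_eq_self]
  | succ n ih =>
    have h := ih (update (update S features (.replicate n .tick)) path
      (encRanges (List.replicate (m + 1) fullRange)).reverse) (by simp) (m + 1) (by simp)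
    refine (Runs.loop_step (t := 6) (by simp [hS, List.replicate_succ]) (.pop ?_) h).of_eq ?_
      (by omega)
    · have hp := runs_pushAll (O := O) path [.negInf, .sep, .posInf, .sep]
        (update S features (.replicate n .tick))
      simp only [hS, List.replicate_succ, List.head?_cons, List.tail_cons, Option.elim_some]
      refine hp.of_eq ?_ (by simp)
      congr 1
      rw [← List.replicate_succ, List.replicate_succ', encRanges, List.flatMap_append,
        List.reverse_append]
      simp [hpath, encRanges, encRange, fullRange, encBound]
    · rw [show m + 1 + n = m + (n + 1) by omega]
      funext r
      by_cases h : r = path <;> by_cases h' : r = features <;> simp [h, h']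

/-- A bound for the time to read an instance. -/
def readTime (Z : ℕ) : ℕ := 24 * Z ^ 3 + 27 * Z ^ 2 + 100 * Z + 100

/-- Besides the list of ranges and the root of the tree, the preparation puts the description with
full ranges only on `path`. It always satisfies the constraint and serves as the first best
description. -/
theorem runs_readInstance (D : Dataset) (k Z : ℕ) (θ : List Sym) (hk : k ≤ Z) (hn : D.n ≤ Z)
    (hD : (encDataset D).length ≤ Z) (hV : (D.bounds.flatMap encBound).length ≤ Z)
    (hc : D.bounds.length ≤ Z) (hb : ∀ a ∈ D.bounds, (boundBody a).length ≤ Z) :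
    Runs O readInstance
      (readStore θ (encNat k ++ encDataset D) [] [] [] [] [] [] [] []).get
      (nodeStore (encDataset D).reverse θ (allRanges D.bounds) [] [] (encNode D.n k []) [] []
        (encRanges (List.replicate D.n fullRange)).reverse [] []).get (readTime Z) := by
  set E := encDataset D with hE
  have hE' : E = List.replicate D.n Sym.tick ++ Sym.sep :: (D.rows ++ [Sym.sep]) := by
    simp [hE, encDataset, encNat, Dataset.rows]
  set V := D.bounds.flatMap encBound with hVdef
  have hstrip := encBounds_eq D
  rw [← hVdef] at hstrip
  set X := strip (D.rows ++ [Sym.sep])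
  have hXZ : X.length + 4 ≤ Z := by
    rw [hstrip] at hV
    simp at hV
    omega
  have hrows : (D.rows ++ [Sym.sep]).length ≤ Z := by
    rw [hE'] at hD
    simp at hD ⊢
    omega
  have h₁ : Runs O (moveUntil Sym.isSep inp budget)
      (readStore θ (encNat k ++ E) [] [] [] [] [] [] [] []).get
      (readStore θ E (.replicate k .tick) [] [] [] [] [] [] []).get (3 * Z + 3) :=
    (runs_moveUntil (by simp) _ (l := List.replicate k .tick) (e := .sep)
      (by simp [Store.get, readStore, encNat]; rfl) (isSep_replicate_tick k) rfl).of_eq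
      (by funext r; cases r <;> simp [Store.get, readStore]) (by simp; omega)
  have h₂ : Runs O (seq (dup inp data tmp) (move tmp inp))
      (readStore θ E (.replicate k .tick) [] [] [] [] [] [] []).get
      (readStore θ E (.replicate k .tick) [] E.reverse [] [] [] [] []).get (7 * Z + 2) :=
    ((runs_dup (by simp) (by simp) (by simp) _).seq (runs_move (by simp) _)).of_eq
      (by funext r; cases r <;> simp [Store.get, readStore])
      (by simp [Store.get, readStore]; omega)
  have h₃ : Runs O (moveUntil Sym.isSep inp features)
      (readStore θ E (.replicate k .tick) [] E.reverse [] [] [] [] []).get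
      (readStore θ (D.rows ++ [Sym.sep]) (.replicate k .tick) (.replicate D.n .tick) E.reverse
        [] [] [] [] []).get (3 * Z + 3) :=
    (runs_moveUntil (by simp) _ (l := List.replicate D.n .tick) (e := .sep)
      (by simp [Store.get, readStore, hE']; rfl) (isSep_replicate_tick D.n) rfl).of_eq
      (by funext r; cases r <;> simp [Store.get, readStore]) (by simp; omega)
  have h₄ : Runs O stripTicks
      (readStore θ (D.rows ++ [Sym.sep]) (.replicate k .tick) (.replicate D.n .tick) E.reverse
        [] [] [] [] []).get
      (readStore θ [] (.replicate k .tick) (.replicate D.n .tick) E.reverse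
        [] X.reverse [] [] []).get (4 * Z + 1) :=
    (runs_stripTicks _ _ rfl).of_eq
      (by funext r; cases r <;> simp [Store.get, readStore, X])
      (by simp [Store.get, readStore] at hrows ⊢; omega)
  have h₅ : Runs O (seq (move vals' vals) (seq (pushAll vals [.sep, .posInf, .sep, .negInf])
      (copy tmp vals vals')))
      (readStore θ [] (.replicate k .tick) (.replicate D.n .tick) E.reverse
        [] X.reverse [] [] []).get
      (readStore θ [] (.replicate k .tick) (.replicate D.n .tick) E.reverse
        V V [] [] []).get (10 * Z + 8) :=
    ((runs_move (by simp) _).seq ((runs_pushAll _ _ _).seq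
      (runs_copy (by simp) (by simp) (by simp) _ (by simp [Store.get, readStore])))).of_eq
      (by funext r; cases r <;> simp [Store.get, readStore, hstrip])
      (by simp [Store.get, readStore]; omega)
  have h₆ : Runs O makePairs
      (readStore θ [] (.replicate k .tick) (.replicate D.n .tick) E.reverse V V [] [] []).get
      (readStore θ [] (.replicate k .tick) (.replicate D.n .tick) E.reverse
        V V (encPairs (allRanges D.bounds)) [] []).get (24 * Z ^ 3 + 27 * Z ^ 2 + 11 * Z + 2) :=
    (runs_makePairs hb _ rfl rfl rfl rfl rfl rfl rfl).of_eq
      (by funext r; cases r <;> simp [Store.get, readStore]) (by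
        calc _ ≤ Z * (10 * Z + 9 + (Z * (24 * Z + 17) + 2)) + 2 := by gcongr
          _ = _ := by ring)
  have h₇ : Runs O (seq (clear vals) (clear vals'))
      (readStore θ [] (.replicate k .tick) (.replicate D.n .tick) E.reverse
        V V (encPairs (allRanges D.bounds)) [] []).get
      (readStore θ [] (.replicate k .tick) (.replicate D.n .tick) E.reverse
        [] [] (encPairs (allRanges D.bounds)) [] []).get (6 * Z + 2) :=
    ((runs_clear _ _).seq (runs_clear _ _)).of_eq
      (by funext r; cases r <;> simp [Store.get, readStore])
      (by simp [Store.get, readStore]; omega)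
  have h₈ : Runs O (seq (pushAll work [.tick, .sep]) (seq (move budget work)
      (seq (push work .sep) (copy tmp features work))))
      (readStore θ [] (.replicate k .tick) (.replicate D.n .tick) E.reverse
        [] [] (encPairs (allRanges D.bounds)) [] []).get
      (readStore θ [] [] (.replicate D.n .tick) E.reverse
        [] [] (encPairs (allRanges D.bounds)) (encNode D.n k []) []).get (10 * Z + 7) :=
    ((runs_pushAll _ _ _).seq ((runs_move (by simp) _).seq ((Runs.push _ _ _).seq
      (runs_copy (by simp) (by simp) (by simp) _ (by simp [Store.get, readStore]))))).of_eq
      (by funext r; cases r <;> simp [Store.get, readStore, encNode, encRanges])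
      (by simp [Store.get, readStore]; omega)
  have h₉ : Runs O (drain features fun _ => pushAll path [.negInf, .sep, .posInf, .sep])
      (readStore θ [] [] (.replicate D.n .tick) E.reverse
        [] [] (encPairs (allRanges D.bounds)) (encNode D.n k []) []).get
      (nodeStore E.reverse θ (allRanges D.bounds) [] [] (encNode D.n k []) [] []
        (encRanges (List.replicate D.n fullRange)).reverse [] []).get (7 * Z + 1) :=
    (runs_fullPath D.n _ rfl 0 rfl).of_eq
      (by funext r; cases r <;> simp [Store.get, readStore, nodeStore]) (by omega)
  refine (h₁.seq (h₂.seq (h₃.seq (h₄.seq (h₅.seq (h₆.seq (h₇.seq (h₈.seq h₉)))))))).mono ?_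
  unfold readTime
  omega

/-- Search for the best description, which is then in the register `best`. -/
def search : Prog :=
  seq readInstance <| seq evaluate <| seq keepPath <| seq (seq (clear path) (clear qual)) <|
    seq searchLoop <| seq (clear data) (clear pairs)

/-- The best description found by the search. -/
def searchResult (D : Dataset) (k : ℕ) (qf : List Range → List Bool)
    (le : List Bool → List Bool → Bool) : List Range :=
  (leaves (allRanges D.bounds) D.n k []).foldl (better qf le) (List.replicate D.n fullRange)

theorem ranges_replicate (gs : List Range) (n : ℕ) : Ranges gs (List.replicate n fullRange) :=
  fun _ hg => .inl (List.eq_of_mem_replicate hg)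

theorem searchResult_ranges (D : Dataset) (k : ℕ) (qf : List Range → List Bool)
    (le : List Bool → List Bool → Bool) :
    Ranges (allRanges D.bounds) (searchResult D k qf le) ∧
      (searchResult D k qf le).length = D.n := by
  refine foldl_better_ranges ⟨ranges_replicate _ _, by simp⟩ fun p hp => ?_
  have := mem_leaves_ranges (p := []) (by simp [Ranges]) hp
  simpa using this

/-- A bound for the time of the search. -/
def searchTime (n k Z TQ TC : ℕ) : ℕ :=
  readTime Z + TQ + 100 * Z + 100 + 12 * Z ^ 3 +
    (n + 1) * (1 + n * (Z * Z)) ^ k * stepTime (Z * Z) Z TQ TC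

theorem length_encPairs_le {gs : List Range} {Z : ℕ} (h : ∀ g ∈ gs, (encRange g).length ≤ Z) :
    (encPairs gs).length ≤ gs.length * (Z + 1) := by
  induction gs with
  | nil => simp [encPairs]
  | cons g gs ih =>
    have h₁ := h g (by simp)
    have h₂ := ih fun g hg => h g (by simp [hg])
    simp only [encPairs, List.flatMap_cons, List.length_append, List.length_cons,
      List.length_nil] at h₂ ⊢
    rw [add_mul, one_mul]
    omega

/-- The register `theta` is carried along untouched, so that the same search serves both problems.
-/
theorem runs_search (D : Dataset) (k Z TQ TC : ℕ) (θ : List Sym) {qf : List Range → List Bool}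
    {le : List Bool → List Bool → Bool}
    (h : Correct O (encDataset D) (allRanges D.bounds) D.n Z TQ TC qf le)
    (hk : k ≤ Z) (hn : D.n ≤ Z) (hV : (D.bounds.flatMap encBound).length ≤ Z)
    (hc : D.bounds.length ≤ Z) (hb : ∀ a ∈ D.bounds, (boundBody a).length ≤ Z) :
    Runs O search
      (Store.get { inp := encNat k ++ encDataset D, theta := θ })
      (Store.get { theta := θ, best := (encRanges (searchResult D k qf le)).reverse,
                   bestQual := qualReg qf (searchResult D k qf le) })
      (searchTime D.n k Z TQ TC) := by
  set gs := allRanges D.bounds with hgs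
  have hgsl : gs.length ≤ Z * Z := by
    rw [hgs, length_allRanges]
    exact Nat.mul_le_mul hc hc
  have hfull := ranges_replicate gs D.n
  have hlen : (List.replicate D.n fullRange).length = D.n := by simp
  have h₁ := runs_readInstance (O := O) D k Z θ hk hn h.length_data hV hc hb
  have h₂ := runs_evaluate (θ := θ) h [] [] (encNode D.n k []) _ hlen hfull
  have h₃ := runs_keepPath (O := O) (Z := Z) (qf := qf) (encDataset D).reverse θ gs
    (List.replicate D.n fullRange) (encNode D.n k []) (h.length_ranges _ hlen.le hfull)
    (h.length_quality _ hlen hfull)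
  have h₄ : Runs O (seq (clear path) (clear qual)) _
      (bestStore (encDataset D) θ gs qf (List.replicate D.n fullRange) (encNode D.n k [] ++ []))
      (6 * Z + 2) :=
    ((runs_clear path (nodeStore (encDataset D).reverse θ gs
      (encRanges (List.replicate D.n fullRange)).reverse
      (qualReg qf (List.replicate D.n fullRange)) (encNode D.n k []) [] []
      (encRanges (List.replicate D.n fullRange)).reverse
      (qualReg qf (List.replicate D.n fullRange)) []).get).seq (runs_clear qual _)).of_eq
      (by funext r; cases r <;> simp [Store.get, nodeStore, bestStore])
      (by
        have := h.length_ranges _ hlen.le hfull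
        have := h.length_quality _ hlen hfull
        simp [Store.get, nodeStore, qualReg]; omega)
  -- Below the root nothing is left on the worklist, so the continuation is the exit of the loop, at
  -- cost 1.
  have h₅ := runs_searchLoop (θ := θ) h D.n k hn hk [] (List.replicate D.n fullRange)
    (by simp [Ranges]) (by simp) ⟨hfull, hlen⟩ [] _ 1
    (.loop_exit (r := work) (p := Option.isSome) (body := searchStep) (by simp [bestStore_work]))
  have h₆ : Runs O (seq (clear data) (clear pairs))
      (bestStore (encDataset D) θ gs qf (searchResult D k qf le) [])
      (Store.get { theta := θ, best := (encRanges (searchResult D k qf le)).reverse,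
                   bestQual := qualReg qf (searchResult D k qf le) })
      (3 * Z + 1 + (3 * (Z * Z * (Z + 1)) + 1)) :=
    ((runs_clear _ _).seq (runs_clear _ _)).of_eq
      (by funext r; cases r <;> simp [Store.get, nodeStore, bestStore])
      (by
        have h₁ := h.length_data
        have h₂ := (length_encPairs_le h.length_range).trans
          (Nat.mul_le_mul_right (Z + 1) hgsl)
        simp [Store.get, nodeStore, bestStore]; omega)
  refine (h₁.seq (h₂.seq (h₃.seq (h₄.seq (h₅.seq h₆))))).mono ?_
  have hnodes : nodeCount gs.length D.n k * stepTime gs.length Z TQ TC ≤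
      (D.n + 1) * (1 + D.n * (Z * Z)) ^ k * stepTime (Z * Z) Z TQ TC := by
    refine Nat.mul_le_mul ((nodeCount_le _ _ _).trans ?_) ?_
    · gcongr
    · unfold stepTime
      gcongr
  have hZ : Z * Z * (Z + 1) ≤ 2 * Z ^ 3 + 1 := by
    have : Z ^ 2 ≤ Z ^ 3 := by
      rcases Z with _ | Z
      · simp
      · exact Nat.pow_le_pow_right (by omega) (by norm_num)
    nlinarith
  unfold searchTime
  omega

end SubgroupDiscovery

namespace SubgroupDiscovery

open Computability Turing Function Cmd
open Reg

/-! ### The programs for both problems -/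

variable {O : Proc → List Sym → List Sym → ℕ → Prop} {D : Dataset} {k Z TQ TC : ℕ}
  {qf : List Range → List Bool} {le : List Bool → List Bool → Bool}

theorem update_inp (l : List Sym) :
    update (fun _ => []) inp l = Store.get { inp := l } := by
  funext r; cases r <;> simp [Store.get]

/-- The program for the search problem; its output is in `best`. -/
def searchProgram : Prog := seq search (clear bestQual)

/-- All words that the search on `D` handles have length at most `Z`, and its procedures
answer correctly and in time. -/
structure Fits (O : Proc → List Sym → List Sym → ℕ → Prop) (D : Dataset)
    (k Z TQ TC : ℕ) (qf : List Range → List Bool) (le : List Bool → List Bool → Bool) : Prop where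
  correct : Correct O (encDataset D) (allRanges D.bounds) D.n Z TQ TC qf le
  budget : k ≤ Z
  features : D.n ≤ Z
  length_bounds : (D.bounds.flatMap encBound).length ≤ Z
  card_bounds : D.bounds.length ≤ Z
  length_bound : ∀ a ∈ D.bounds, (boundBody a).length ≤ Z

theorem length_quality_searchResult (h : Fits O D k Z TQ TC qf le) :
    (qf (searchResult D k qf le)).length ≤ Z := by
  obtain ⟨h₁, h₂⟩ := searchResult_ranges D k qf le
  exact h.correct.length_quality _ h₂ h₁

theorem runs_searchProgram (h : Fits O D k Z TQ TC qf le) :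
    Runs O searchProgram (update (fun _ => []) inp (encNat k ++ encDataset D))
      (update (fun _ => []) best (encRanges (searchResult D k qf le)).reverse)
      (searchTime D.n k Z TQ TC + 3 * Z + 1) := by
  refine ((runs_search D k Z TQ TC [] h.correct h.budget h.features h.length_bounds h.card_bounds
    h.length_bound).seq (runs_clear bestQual _)).congr (update_inp _) ?_ ?_
  · funext r; cases r <;> simp [Store.get]
  · have := length_quality_searchResult h
    simp [Store.get, qualReg]
    omega

/-- Move the last word of the instance to the register `theta`. -/
def takeTheta : Prog :=
  seq (move inp tmp) <| seq (pop tmp fun _ => skip) <| seq (moveUntil Sym.isSep tmp query) <|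
    seq (move query theta) <| seq (push tmp .sep) (move tmp inp)

/-- The program for the decision problem; its output is in `answer`. -/
def decisionProgram : Prog :=
  seq takeTheta <| seq search <| seq (compareNames theta bestQual) <|
    seq (clear theta) <| seq (clear best) (clear bestQual)

/-- The threshold is the last word, so it is found by turning the input around and reading up to the
second separator. That separator belongs to the dataset and is put back. -/
theorem runs_takeTheta (l : List Sym) (w : List Bool) {Z : ℕ} (hl : l.length ≤ Z)
    (hw : w.length ≤ Z) :
    Runs O takeTheta (Store.get { inp := l ++ [Sym.sep] ++ encWord w })
      (Store.get { inp := l ++ [Sym.sep], theta := (w.map Sym.bit).reverse })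
      (18 * Z + 30) := by
  have h₁ : Runs O (move inp tmp) (Store.get { inp := l ++ [Sym.sep] ++ encWord w })
      (Store.get { tmp := Sym.sep :: ((w.map Sym.bit).reverse ++ Sym.sep :: l.reverse) })
      (6 * Z + 7) :=
    (runs_move (by simp) _).of_eq (by funext r; cases r <;> simp [Store.get, encWord])
      (by simp [Store.get, encWord]; omega)
  have h₂ : Runs O (pop tmp fun _ => skip)
      (Store.get { tmp := Sym.sep :: ((w.map Sym.bit).reverse ++ Sym.sep :: l.reverse) })
      (Store.get { tmp := (w.map Sym.bit).reverse ++ Sym.sep :: l.reverse }) 2 :=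
    (Runs.pop (.skip _)).of_eq (by funext r; cases r <;> simp [Store.get]) (by omega)
  have h₃ : Runs O (moveUntil Sym.isSep tmp query)
      (Store.get { tmp := (w.map Sym.bit).reverse ++ Sym.sep :: l.reverse })
      (Store.get { tmp := l.reverse, query := w.map Sym.bit }) (3 * Z + 3) :=
    (runs_moveUntil (p := Sym.isSep) (src := tmp) (dst := query) (by simp)
      (Store.get { tmp := (w.map Sym.bit).reverse ++ Sym.sep :: l.reverse })
      (l := (w.map Sym.bit).reverse) (e := .sep) rfl
      (fun a ha => by
        obtain ⟨b, _, rfl⟩ := List.mem_map.1 (List.mem_reverse.1 ha)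
        rfl) rfl).of_eq
      (by funext r; cases r <;> simp [Store.get]) (by simp; omega)
  have h₄ : Runs O (move query theta)
      (Store.get { tmp := l.reverse, query := w.map Sym.bit })
      (Store.get { tmp := l.reverse, theta := (w.map Sym.bit).reverse }) (3 * Z + 1) :=
    (runs_move (by simp) _).of_eq (by funext r; cases r <;> simp [Store.get])
      (by simp [Store.get]; omega)
  have h₅ : Runs O (seq (push tmp .sep) (move tmp inp))
      (Store.get { tmp := l.reverse, theta := (w.map Sym.bit).reverse })
      (Store.get { inp := l ++ [Sym.sep], theta := (w.map Sym.bit).reverse }) (3 * Z + 5) :=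
    ((Runs.push _ _ _).seq (runs_move (by simp) _)).of_eq
      (by funext r; cases r <;> simp [Store.get]) (by simp [Store.get]; omega)
  exact (h₁.seq (h₂.seq (h₃.seq (h₄.seq h₅)))).mono (by omega)

theorem runs_decisionProgram (h : Fits O D k Z TQ TC qf le) (w : List Bool) (hw : w.length ≤ Z)
    (hk : k + (encDataset D).length ≤ Z) :
    Runs O decisionProgram (update (fun _ => []) inp (encNat k ++ encDataset D ++ encWord w))
      (update (fun _ => []) answer [Sym.bit (le w (qf (searchResult D k qf le)))])
      (searchTime D.n k Z TQ TC + TC + 60 * Z + 60) := by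
  have hq := length_quality_searchResult h
  have hr := h.correct.length_ranges _ (searchResult_ranges D k qf le).2.le
    (searchResult_ranges D k qf le).1
  -- The end mark of the dataset is the separator in front of the threshold.
  obtain ⟨l, hl⟩ : ∃ l, encNat k ++ encDataset D = l ++ [Sym.sep] := ⟨_, by
    rw [encDataset, ← List.append_assoc]⟩
  have hlZ : l.length ≤ Z := by
    have := congrArg List.length hl
    simp [encNat] at this
    omega
  have h₁ := runs_takeTheta (O := O) l w hlZ hw
  rw [← hl] at h₁
  have h₂ := runs_search D k Z TQ TC (w.map Sym.bit).reverse h.correct h.budget h.features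
    h.length_bounds h.card_bounds h.length_bound
  have h₃ := runs_compareNames h.correct (x := theta) (y := bestQual) hw hq
    (Store.get {
      theta := (w.map Sym.bit).reverse
      best := (encRanges (searchResult D k qf le)).reverse
      bestQual := qualReg qf (searchResult D k qf le) }) rfl rfl (by simp) (by simp) rfl rfl rfl
  refine (h₁.seq (h₂.seq (h₃.seq ((runs_clear _ _).seq ((runs_clear _ _).seq
    (runs_clear _ _)))))).congr (update_inp _) ?_ ?_
  · funext r; cases r <;> simp [Store.get]
  · simp [Store.get, qualReg]
    omega

end SubgroupDiscovery

namespace SubgroupDiscovery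

open Computability Turing Function Cmd

/-! ### Polynomial bounds -/

/-- `F` is bounded by a power of its argument. -/
def PowerBounded (F : ℕ → ℕ) : Prop := ∃ d, ∀ x, 2 ≤ x → F x ≤ x ^ d

namespace PowerBounded

/-- Arguments are at least 2, so constants and factors go into the exponent. This is what allows the
factor f(k) in the final time bound to be 1. -/
theorem const (c : ℕ) : PowerBounded fun _ => c :=
  ⟨c, fun _ hx => (Nat.lt_two_pow_self).le.trans (Nat.pow_le_pow_left hx c)⟩

theorem id : PowerBounded fun x => x := ⟨1, fun x _ => by simp⟩

theorem mul {F G : ℕ → ℕ} (hF : PowerBounded F) (hG : PowerBounded G) :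
    PowerBounded fun x => F x * G x := by
  obtain ⟨a, ha⟩ := hF
  obtain ⟨b, hb⟩ := hG
  exact ⟨a + b, fun x hx => (Nat.mul_le_mul (ha x hx) (hb x hx)).trans (pow_add x a b).ge⟩

theorem add {F G : ℕ → ℕ} (hF : PowerBounded F) (hG : PowerBounded G) :
    PowerBounded fun x => F x + G x := by
  obtain ⟨a, ha⟩ := hF
  obtain ⟨b, hb⟩ := hG
  refine ⟨a + b + 1, fun x hx => ?_⟩
  have h₁ : x ^ a ≤ x ^ (a + b) := Nat.pow_le_pow_right (by omega) (by omega)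
  have h₂ : x ^ b ≤ x ^ (a + b) := Nat.pow_le_pow_right (by omega) (by omega)
  calc F x + G x ≤ x ^ (a + b) * 2 := by have := ha x hx; have := hb x hx; omega
    _ ≤ x ^ (a + b) * x := Nat.mul_le_mul_left _ hx
    _ = x ^ (a + b + 1) := (pow_succ _ _).symm

theorem pow {F : ℕ → ℕ} (hF : PowerBounded F) (n : ℕ) : PowerBounded fun x => F x ^ n := by
  obtain ⟨a, ha⟩ := hF
  exact ⟨a * n, fun x hx => (Nat.pow_le_pow_left (ha x hx) n).trans (pow_mul x a n).ge⟩

theorem eval {F : ℕ → ℕ} (hF : PowerBounded F) (P : Polynomial ℕ) :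
    PowerBounded fun x => P.eval (F x) := by
  induction P using Polynomial.induction_on' with
  | add P P' h h' => simpa using h.add h'
  | monomial n a => simpa using (const a).mul (hF.pow n)

end PowerBounded

theorem eval_mono (P : Polynomial ℕ) {x y : ℕ} (h : x ≤ y) : P.eval x ≤ P.eval y := by
  induction P using Polynomial.induction_on' with
  | add P P' h₁ h₂ => simpa using Nat.add_le_add h₁ h₂
  | monomial n a => simpa using Nat.mul_le_mul_left a (Nat.pow_le_pow_left h n)

/-- The exponents `a` and `b` do not depend on `k`: only the power of `F₃` contributes a multiple of
`k`. The sum of two terms costs a factor 2, absorbed by one more power of `x`. -/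
theorem exists_xp_bound {F₁ F₂ F₃ : ℕ → ℕ} (h₁ : PowerBounded F₁) (h₂ : PowerBounded F₂)
    (h₃ : PowerBounded F₃) : ∃ a b : ℕ, ∀ x k, 2 ≤ x → F₁ x + F₂ x * F₃ x ^ k ≤ x ^ (a + b * k) := by
  obtain ⟨a₁, h₁⟩ := h₁
  obtain ⟨a₂, h₂⟩ := h₂
  obtain ⟨a₃, h₃⟩ := h₃
  refine ⟨a₁ + a₂ + 1, a₃, fun x k hx => ?_⟩
  have e₁ : x ^ a₁ ≤ x ^ (a₁ + a₂ + a₃ * k) := Nat.pow_le_pow_right (by omega) (by omega)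
  have e₂ : x ^ (a₂ + a₃ * k) ≤ x ^ (a₁ + a₂ + a₃ * k) :=
    Nat.pow_le_pow_right (by omega) (by omega)
  have e₃ : F₂ x * F₃ x ^ k ≤ x ^ (a₂ + a₃ * k) := by
    rw [pow_add, pow_mul]
    exact Nat.mul_le_mul (h₂ x hx) (Nat.pow_le_pow_left (h₃ x hx) k)
  calc F₁ x + F₂ x * F₃ x ^ k ≤ x ^ (a₁ + a₂ + a₃ * k) * 2 := by have := h₁ x hx; omega
    _ ≤ x ^ (a₁ + a₂ + a₃ * k) * x := Nat.mul_le_mul_left _ hx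
    _ = x ^ (a₁ + a₂ + 1 + a₃ * k) := by rw [← pow_succ]; congr 1; omega

/-! ### The procedures -/

/-- The description with the given ranges. -/
def descOf (n : ℕ) (p : List Range) : Desc n where
  lb j := (p.getD j fullRange).1
  ub j := (p.getD j fullRange).2

/-- With exactly `n` ranges, the default value in `descOf` is never reached. -/
theorem encDesc_descOf {n : ℕ} {p : List Range} (hp : p.length = n) :
    encDesc (descOf n p) = encRanges p := by
  subst hp
  have : p = (List.finRange p.length).map fun j : Fin p.length => p.getD (j : ℕ) fullRange := by
    apply List.ext_getElem <;> simp
  conv_rhs => rw [this, encRanges, List.flatMap_map]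
  rfl

theorem length_strip_le (l : List Sym) : (strip l).length ≤ l.length := by
  induction l using strip.induct with
  | case1 a l ih => simp [strip]; omega
  | case2 => simp [strip]
  | case3 a l h₁ h₂ ih => rw [strip.eq_3 a l h₁ h₂]; simpa using ih
  | case4 => simp [strip]

/-- Stripping does not lengthen a word; the 4 extra symbols are the two infinities with their end
marks. -/
theorem length_bounds_le (D : Dataset) :
    (D.bounds.flatMap encBound).length ≤ (encDataset D).length + 4 := by
  have h := length_strip_le (D.rows ++ [Sym.sep])
  have e : encDataset D = encNat D.n ++ (D.rows ++ [Sym.sep]) := List.append_assoc _ _ _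
  rw [encBounds_eq, e]
  simp at h ⊢
  omega

theorem length_flatMap_of_mem {α β : Type} {f : α → List β} {L : List α} {a : α} (ha : a ∈ L) :
    (f a).length ≤ (L.flatMap f).length := by
  rw [List.length_flatMap]
  exact List.le_sum_of_mem (List.mem_map_of_mem ha)

theorem length_le_flatMap_encBound (L : List Bound) : L.length ≤ (L.flatMap encBound).length := by
  induction L with
  | nil => simp
  | cons a L ih => simp [encBound_eq] at ih ⊢; omega

theorem length_encRanges_le {B : ℕ} {p : List Range} (h : ∀ g ∈ p, (encRange g).length ≤ B) :
    (encRanges p).length ≤ p.length * B := by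
  rw [encRanges, List.length_flatMap, ← List.length_map (fun g => (encRange g).length)]
  refine List.sum_le_card_nsmul _ B fun a ha => ?_
  obtain ⟨g, hg, rfl⟩ := List.mem_map.1 ha
  exact h g hg

theorem length_encRange_le {D : Dataset} {g : Range} (hg : g ∈ allRanges D.bounds) :
    (encRange g).length ≤ 2 * (encDataset D).length + 8 := by
  obtain ⟨h₁, h₂⟩ := mem_allRanges.1 hg
  have h₃ := length_flatMap_of_mem (f := encBound) h₁
  have h₄ := length_flatMap_of_mem (f := encBound) h₂
  have := length_bounds_le D
  simp only [encRange, List.length_append]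
  omega

theorem features_add_two_le_length (D : Dataset) : D.n + 2 ≤ (encDataset D).length := by
  simp [encDataset, encNat]

theorem map_bit_eq {Γ : Type} (e : Γ ≃ Bool) (w : List Bool) :
    w.map Sym.bit = (w.map e.invFun).map (Sym.bit ∘ e) := by
  simp

section Procedures

variable {q : (D : Dataset) × Desc D.n → List Bool} {le : List Bool × List Bool → Bool}
  (Cq : TM2ComputableInPolyTime encDatasetDesc id q)
  (Cν : TM2ComputableInPolyTime encWords encodeBool le)

/-- The machines for the two procedures. -/
def procMachine : Proc → TM2ComputableAux Sym Bool
  | .quality => Cq.toTM2ComputableAux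
  | .compare => Cν.toTM2ComputableAux

/-- The procedures, as carried out by their machines. -/
def ProcOracle : Proc → List Sym → List Sym → ℕ → Prop :=
  MachineOracle (fun i => (procMachine Cq Cν i).tm)
    (fun i => (procMachine Cq Cν i).inputAlphabet.invFun)
    (fun i => Sym.bit ∘ (procMachine Cq Cν i).outputAlphabet)

theorem outputsInTime_mono {N : FinTM2} {l o t t'} (h : TM2OutputsInTime N l o t) (ht : t ≤ t') :
    Nonempty (TM2OutputsInTime N l o t') :=
  ⟨⟨h.toEvalsTo, h.steps_le_m.trans ht⟩⟩

theorem procOracle_quality (D : Dataset) {p : List Range} (hp : p.length = D.n) {t : ℕ}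
    (ht : Cq.time.eval (encDataset D ++ encRanges p).length ≤ t) :
    ProcOracle Cq Cν .quality (encDataset D ++ encRanges p)
      ((q ⟨D, descOf D.n p⟩).map Sym.bit) t := by
  have h := Cq.outputsFun ⟨D, descOf D.n p⟩
  rw [encDatasetDesc, encDesc_descOf hp] at h
  exact ⟨_, outputsInTime_mono h ht, map_bit_eq _ _⟩

theorem procOracle_compare (w w' : List Bool) {t : ℕ}
    (ht : Cν.time.eval (encWords (w, w')).length ≤ t) :
    ProcOracle Cq Cν .compare (encWords (w, w')) [Sym.bit (le (w, w'))] t :=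
  ⟨_, outputsInTime_mono (Cν.outputsFun (w, w')) ht, map_bit_eq _ [_]⟩

/-- The bounds are functions of any `x` that is at least the size of threshold and dataset, so they
apply with `x` the length of an instance of either problem. -/
theorem exists_fits : ∃ Z TQ TC : ℕ → ℕ, PowerBounded Z ∧ PowerBounded TQ ∧ PowerBounded TC ∧
    ∀ (D : Dataset) (k x : ℕ), k + (encDataset D).length ≤ x → x ≤ Z x ∧
      Fits (ProcOracle Cq Cν) D k (Z x) (TQ x) (TC x) (fun p => q ⟨D, descOf D.n p⟩)
        (fun w w' => le (w, w')) := by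
  obtain ⟨C, hC⟩ := exists_output_length_le Cq.tm
  -- A bound for the quality queries: the dataset, and at most `x` ranges whose two bounds have
  -- total length at most `2 * x + 10`.
  let L : ℕ → ℕ := fun x => x + x * (2 * x + 10) + 10
  have hL : PowerBounded L := (PowerBounded.id.add (PowerBounded.id.mul
    (((PowerBounded.const 2).mul .id).add (.const 10)))).add (.const 10)
  -- The second term allows for the name of a quality, as written by its machine. A comparison query
  -- consists of two words of length at most `Z x` and two separators.
  let Z : ℕ → ℕ := fun x => L x + Cq.time.eval (L x) * C
  have hZ : PowerBounded Z := hL.add ((hL.eval _).mul (.const C))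
  refine ⟨Z, fun x => Cq.time.eval (L x), fun x => Cν.time.eval (2 * Z x + 2), hZ, hL.eval _,
    (((PowerBounded.const 2).mul hZ).add (.const 2)).eval _, fun D k x hx => ?_⟩
  set E := (encDataset D).length with hE
  have hn := features_add_two_le_length D
  have hb := length_bounds_le D
  have hLx : L x = x + x * (2 * x + 10) + 10 := rfl
  have hZx : Z x = L x + Cq.time.eval (L x) * C := rfl
  have h₁ : ∀ p, p.length ≤ D.n → Ranges (allRanges D.bounds) p →
      (encRanges p).length ≤ x * (2 * x + 10) := by
    intro p hp hr
    refine (length_encRanges_le (B := 2 * x + 10) fun g hg => ?_).trans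
      (Nat.mul_le_mul_right _ (by omega))
    rcases hr g hg with rfl | h
    · exact (by simp : 4 ≤ 2 * x + 10)
    · have := length_encRange_le h
      omega
  have h₂ : ∀ p, p.length = D.n → Ranges (allRanges D.bounds) p →
      (encDataset D ++ encRanges p).length ≤ L x := by
    intro p hp hr
    have := h₁ p hp.le hr
    rw [List.length_append]
    omega
  have h₃ : 2 * x ≤ x * (2 * x + 10) := by nlinarith
  refine ⟨by omega, ⟨?_, ?_, by omega, ?_, ?_, ?_⟩, by omega, by omega, by omega, ?_, ?_⟩
  · exact fun p hp hr => procOracle_quality Cq Cν D hp (eval_mono _ (h₂ p hp hr))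
  · refine fun w w' hw hw' => procOracle_compare Cq Cν w w' (eval_mono _ ?_)
    simp [encWords, encWord]
    omega
  · intro g hg
    have := length_encRange_le hg
    omega
  · intro p hp hr
    have := h₁ p hp hr
    omega
  · intro p hp hr
    obtain ⟨o', ⟨h⟩, ho⟩ := procOracle_quality Cq Cν D hp (eval_mono Cq.time (h₂ p hp hr))
    have h₄ := hC _ _ _ ⟨h⟩
    have h₅ := h₂ p hp hr
    have h₆ : (q ⟨D, descOf D.n p⟩).length = o'.length := by simpa using congrArg List.length ho
    have h₇ := h₄.trans (Nat.add_le_add_right (List.length_map _).le _)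
    exact h₆.le.trans (h₇.trans (Nat.add_le_add_right h₅ _))
  · have := length_le_flatMap_encBound D.bounds
    omega
  · intro a ha
    have := length_flatMap_of_mem (f := encBound) ha
    rw [encBound_eq, List.length_append] at this
    omega

end Procedures

end SubgroupDiscovery

namespace SubgroupDiscovery

open Computability Turing Function Cmd
open Reg

/-! ### Both problems in XP -/

/-- The time of both programs, without the search itself. -/
def overhead (Z TQ TC : ℕ) : ℕ :=
  readTime Z + TQ + TC + 12 * Z ^ 3 + 200 * Z + 200

theorem searchTime_le {n k Z TQ TC : ℕ} (hn : n ≤ Z) :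
    searchTime n k Z TQ TC + TC + 64 * Z + 64 ≤ overhead Z TQ TC +
      (Z + 1) * stepTime (Z * Z) Z TQ TC * (1 + Z * (Z * Z)) ^ k := by
  have h : (n + 1) * (1 + n * (Z * Z)) ^ k * stepTime (Z * Z) Z TQ TC ≤
      (Z + 1) * (1 + Z * (Z * Z)) ^ k * stepTime (Z * Z) Z TQ TC := by gcongr
  calc searchTime n k Z TQ TC + TC + 64 * Z + 64 ≤ overhead Z TQ TC +
      (Z + 1) * (1 + Z * (Z * Z)) ^ k * stepTime (Z * Z) Z TQ TC := by
        unfold searchTime overhead; omega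
    _ = _ := by ring

theorem exists_searchTime_bound {Z TQ TC : ℕ → ℕ} (hZ : PowerBounded Z) (hTQ : PowerBounded TQ)
    (hTC : PowerBounded TC) : ∃ a b : ℕ, ∀ n k x, 2 ≤ x → n ≤ Z x →
      searchTime n k (Z x) (TQ x) (TC x) + TC x + 64 * Z x + 64 ≤ x ^ (a + b * k) := by
  have c := PowerBounded.const
  have h₁ : PowerBounded fun x => overhead (Z x) (TQ x) (TC x) :=
    ((((((((c 24).mul (hZ.pow 3)).add ((c 27).mul (hZ.pow 2))).add ((c 100).mul hZ)).add
      (c 100)).add hTQ).add hTC).add ((c 12).mul (hZ.pow 3))).add ((c 200).mul hZ) |>.add (c 200)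
  have h₂ : PowerBounded fun x => (Z x + 1) * stepTime (Z x * Z x) (Z x) (TQ x) (TC x) :=
    (hZ.add (c 1)).mul (((hTQ.add hTC).add (((hZ.mul hZ).add (c 1)).mul
      (((c 80).mul hZ).add (c 80)))).add (c 2))
  have h₃ : PowerBounded fun x => 1 + Z x * (Z x * Z x) := (c 1).add (hZ.mul (hZ.mul hZ))
  obtain ⟨a, b, h⟩ := exists_xp_bound h₁ h₂ h₃
  exact ⟨a, b, fun n k x hx hn => (searchTime_le hn).trans (h x k hx)⟩

theorem computable_affine (a b : ℕ) : Computable fun k : ℕ => a + b * k :=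
  (Primrec.nat_add.comp (Primrec.const a)
    (Primrec.nat_mul.comp (Primrec.const b) Primrec.id)).to_comp

namespace Cmd

variable {R A B ι : Type} [DecidableEq R] [Fintype R] [Fintype A] [Fintype ι]
  [DecidableEq ι] [Inhabited A]

/-- The machine of a program, with its alphabets. -/
noncomputable def machineAux (M : ι → FinTM2) (enc : ∀ i, A → (M i).Γ (M i).k₀)
    (dec : ∀ i, (M i).Γ (M i).k₁ → A) (f : A → B) (c : Cmd R A ι) (inp out : R) :
    TM2ComputableAux A B where
  tm := machine M enc dec f c inp out
  inputAlphabet := Equiv.refl A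
  outputAlphabet := Equiv.refl B

theorem Runs.machineAux_outputsInTime {M : ι → FinTM2} {enc : ∀ i, A → (M i).Γ (M i).k₀}
    {dec : ∀ i, (M i).Γ (M i).k₁ → A} {c : Cmd R A ι} {inp out : R} {l o : List A} {t : ℕ}
    (f : A → B)
    (h : Runs (MachineOracle M enc dec) c (update (fun _ => []) inp l)
      (update (fun _ => []) out o) t) {t' : ℕ} (ht : t + (o.length + 1) ≤ t') :
    Nonempty (TM2OutputsInTime (machineAux M enc dec f c inp out).tm
      (l.map (machineAux M enc dec f c inp out).inputAlphabet.invFun)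
      (some ((o.map f).reverse.map (machineAux M enc dec f c inp out).outputAlphabet.invFun))
      t') := by
  obtain ⟨h⟩ := h.outputsInTime f
  obtain ⟨h⟩ := outputsInTime_mono h ht
  have e₁ : l.map (machineAux M enc dec f c inp out).inputAlphabet.invFun = l := List.map_id l
  have e₂ : (o.map f).reverse.map (machineAux M enc dec f c inp out).outputAlphabet.invFun =
    (o.map f).reverse := List.map_id _
  rw [e₁, e₂]
  exact ⟨h⟩

end Cmd

section

variable {q : (D : Dataset) × Desc D.n → List Bool} {le : List Bool × List Bool → Bool}

/-- The description found by the search. -/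
def bestDesc (q : (D : Dataset) × Desc D.n → List Bool) (le : List Bool × List Bool → Bool)
    (D : Dataset) (k : ℕ) : Desc D.n :=
  descOf D.n (searchResult D k (fun p => q ⟨D, descOf D.n p⟩) fun w w' => le (w, w'))

theorem bestDesc_searchInXP (hq : PolyTimeComputable encDatasetDesc id q)
    (hle : PolyTimeComputable encWords encodeBool le) :
    SearchInXP (β := fun x : Dataset × ℕ => Desc x.1.n) encSearch (fun _ s => encDesc s)
      (fun x => x.2) (fun x s => s = bestDesc q le x.1 x.2) := by
  obtain ⟨Cq⟩ := hq
  obtain ⟨Cν⟩ := hle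
  obtain ⟨Z, TQ, TC, hZ, hTQ, hTC, h⟩ := exists_fits Cq Cν
  obtain ⟨a, b, hab⟩ := exists_searchTime_bound hZ hTQ hTC
  refine ⟨machineAux (fun i => (procMachine Cq Cν i).tm)
    (fun i => (procMachine Cq Cν i).inputAlphabet.invFun)
    (fun i => Sym.bit ∘ (procMachine Cq Cν i).outputAlphabet) id searchProgram inp best,
    fun _ => 1, fun k => a + b * k, Computable.const 1, computable_affine a b,
    fun ⟨D, k⟩ => ⟨_, rfl, ?_⟩⟩
  have hl : (encSearch (D, k)).length = k + 1 + (encDataset D).length := by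
    simp [encSearch, encNat]
    omega
  obtain ⟨hx, hfit⟩ := h D k (encSearch (D, k)).length (by omega)
  obtain ⟨hr, hn⟩ := searchResult_ranges D k (fun p => q ⟨D, descOf D.n p⟩)
    fun w w' => le (w, w')
  have hlen := hfit.correct.length_ranges _ hn.le hr
  have := features_add_two_le_length D
  have ht := hab D.n k (encSearch (D, k)).length (by omega) hfit.features
  have hrun := (runs_searchProgram hfit).machineAux_outputsInTime (f := id)
    (t' := 1 * (encSearch (D, k)).length ^ (a + b * k))
    (by rw [List.length_reverse, one_mul]; omega)
  rw [List.map_id, List.reverse_reverse, ← encDesc_descOf hn] at hrun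
  exact hrun

/-- The answer of the decision program. -/
def Sym.isTrue : Sym → Bool
  | .bit b => b
  | _ => false

theorem bestDesc_decisionInXP (hq : PolyTimeComputable encDatasetDesc id q)
    (hle : PolyTimeComputable encWords encodeBool le) :
    DecisionInXP encDecision (fun x => x.2.1) fun x : Dataset × ℕ × List Bool =>
      le (x.2.2, q ⟨x.1, bestDesc q le x.1 x.2.1⟩) = true := by
  obtain ⟨Cq⟩ := hq
  obtain ⟨Cν⟩ := hle
  obtain ⟨Z, TQ, TC, hZ, hTQ, hTC, h⟩ := exists_fits Cq Cν
  obtain ⟨a, b, hab⟩ := exists_searchTime_bound hZ hTQ hTC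
  refine ⟨machineAux (fun i => (procMachine Cq Cν i).tm)
    (fun i => (procMachine Cq Cν i).inputAlphabet.invFun)
    (fun i => Sym.bit ∘ (procMachine Cq Cν i).outputAlphabet) Sym.isTrue decisionProgram inp
      answer,
    fun _ => 1, fun k => a + b * k, Computable.const 1, computable_affine a b,
    fun ⟨D, k, w⟩ => ⟨_, Iff.rfl, ?_⟩⟩
  have hl : (encDecision (D, k, w)).length =
      k + 1 + (encDataset D).length + (w.length + 1) := by
    simp [encDecision, encNat, encWord]
    omega
  obtain ⟨hx, hfit⟩ := h D k (encDecision (D, k, w)).length (by omega)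
  have ht := hab D.n k (encDecision (D, k, w)).length (by omega) hfit.features
  exact (runs_decisionProgram hfit w (by omega) (by omega)).machineAux_outputsInTime Sym.isTrue
    (t' := 1 * (encDecision (D, k, w)).length ^ (a + b * k))
    (by rw [List.length_singleton, one_mul]; omega)

end

end SubgroupDiscovery

namespace SubgroupDiscovery

open Computability Turing Function Cmd

/-! ### Optimality of the search result -/

/-- Whether a range is not the full range. -/
def restricts : Range → Bool
  | (.negInf, .posInf) => false
  | _ => true

theorem restricts_iff {g : Range} : restricts g = true ↔ g ≠ fullRange := by
  rcases g with ⟨_ | _ | _, _ | _ | _⟩ <;> simp [restricts, fullRange]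

/-- Only a step that spends budget can add a range other than the full one. It need not do so, as
`gs` may contain the full range. -/
theorem countP_le_of_mem_leaves {gs : List Range} {r b : ℕ} {p l : List Range}
    (hl : l ∈ leaves gs r b p) : l.countP restricts ≤ p.countP restricts + b := by
  induction r generalizing b p with
  | zero => simp [leaves] at hl; subst hl; omega
  | succ r ih =>
    have hfull : (fullRange :: p).countP restricts = p.countP restricts := by
      simp [restricts, fullRange]
    rcases b with _ | b
    · exact hfull ▸ ih (p := fullRange :: p) hl
    · rcases List.mem_append.1 hl with hl | hl
      · obtain ⟨g, _, hl⟩ := List.mem_flatMap.1 hl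
        have h₁ := ih hl
        have h₂ : (g :: p).countP restricts ≤ p.countP restricts + 1 := by
          rw [List.countP_cons]; split <;> omega
        omega
      · exact hfull ▸ ih hl

/-- Going down the tree, take the free branch at each full range and spend budget at each other
range. Ranges are added at the front, so the leaf shows `l` reversed. -/
theorem mem_leaves {gs : List Range} {l : List Range} (hl : Ranges gs l) {b : ℕ}
    (hb : l.countP restricts ≤ b) (p : List Range) :
    l.reverse ++ p ∈ leaves gs l.length b p := by
  induction l generalizing b p with
  | nil => simp [leaves]
  | cons g l ih =>
    have hl' : Ranges gs l := fun x hx => hl x (List.mem_cons_of_mem _ hx)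
    rw [List.reverse_cons, List.append_assoc, List.singleton_append]
    by_cases hg : g = fullRange
    · subst hg
      have h := ih hl' (b := b) (by simpa [List.countP_cons, restricts, fullRange] using hb)
        (fullRange :: p)
      rcases b with _ | b
      · exact h
      · exact List.mem_append_right _ h
    · rw [List.countP_cons_of_pos (restricts_iff.2 hg)] at hb
      obtain ⟨b, rfl⟩ : ∃ b', b = b' + 1 := ⟨b - 1, by omega⟩
      refine List.mem_append_left _ (List.mem_flatMap.2 ⟨g, ?_, ih hl' (by omega) (g :: p)⟩)
      exact List.mem_reverse.2 ((hl g List.mem_cons_self).resolve_left hg)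

theorem countP_finRange {n : ℕ} (P : Fin n → Bool) :
    (List.finRange n).countP P = {j | P j = true}.ncard := by
  rw [List.countP_eq_length_filter,
    ← List.toFinset_card_of_nodup ((List.nodup_finRange n).filter P), ← Set.ncard_coe_finset]
  congr 1
  ext j
  simp

/-- The fold is a running maximum of `v`: since the order of ℝ is total, a failed comparison shows
that the old description is better. -/
theorem foldl_better {qf : List Range → List Bool} {le : List Bool → List Bool → Bool}
    {v : List Range → ℝ} (hv : ∀ s p, le (qf s) (qf p) = true ↔ v s ≤ v p)
    (L : List (List Range)) (s : List Range) :
    (L.foldl (better qf le) s = s ∨ L.foldl (better qf le) s ∈ L) ∧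
      v s ≤ v (L.foldl (better qf le) s) ∧ ∀ p ∈ L, v p ≤ v (L.foldl (better qf le) s) := by
  induction L generalizing s with
  | nil => simp
  | cons p L ih =>
    obtain ⟨h₁, h₂, h₃⟩ := ih (better qf le s p)
    rw [List.foldl_cons]
    have h₄ : better qf le s p = s ∨ better qf le s p = p := by
      unfold better; split <;> simp
    have h₅ : v s ≤ v (better qf le s p) ∧ v p ≤ v (better qf le s p) := by
      unfold better
      split_ifs with h
      · exact ⟨(hv s p).1 h, le_rfl⟩
      · exact ⟨le_rfl, (not_le.1 (mt (hv s p).2 h)).le⟩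
    refine ⟨?_, h₅.1.trans h₂, ?_⟩
    · rcases h₁ with h₁ | h₁
      · rw [h₁]
        exact h₄.imp_right fun h => by simp [h]
      · exact .inr (List.mem_cons_of_mem _ h₁)
    · intro p' hp'
      rcases List.mem_cons.1 hp' with rfl | hp'
      · exact h₅.2.trans h₂
      · exact h₃ p' hp'

theorem num_mem_bounds (D : Dataset) (i : Fin D.m) (j : Fin D.n) :
    Bound.num (D.X i j) ∈ D.bounds := by
  have : D.X i j ∈ D.words :=
    List.mem_flatMap.2 ⟨i, List.mem_finRange i, List.mem_map.2 ⟨j, List.mem_finRange j, rfl⟩⟩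
  simp [Dataset.bounds, this]

/-- Raise `lb` to the smallest entry of the column that satisfies it; this excludes no further
entry. If no entry satisfies it, +∞ excludes all of them as well. -/
theorem exists_lower_bound (D : Dataset) (ν : List Bool → ℝ) (j : Fin D.n) (lb : EReal) :
    ∃ a ∈ D.bounds, ∀ i, lb ≤ (D.realX ν i j : EReal) ↔ a.val ν ≤ (D.realX ν i j : EReal) := by
  classical
  by_cases h : ∃ i, lb ≤ (D.realX ν i j : EReal)
  · obtain ⟨i, hi⟩ := h
    obtain ⟨i₀, h₀, hmin⟩ := Finset.exists_min_image
      (Finset.univ.filter fun i => lb ≤ (D.realX ν i j : EReal)) (fun i => D.realX ν i j)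
      ⟨i, by simpa using hi⟩
    simp only [Finset.mem_filter, Finset.mem_univ, true_and] at h₀ hmin
    exact ⟨_, num_mem_bounds D i₀ j, fun i =>
      ⟨fun h => EReal.coe_le_coe_iff.2 (hmin i h), fun h => h₀.trans h⟩⟩
  · push Not at h
    exact ⟨.posInf, by simp [Dataset.bounds], fun i => by simp [Bound.val, h i]⟩

theorem exists_upper_bound (D : Dataset) (ν : List Bool → ℝ) (j : Fin D.n) (ub : EReal) :
    ∃ a ∈ D.bounds, ∀ i, (D.realX ν i j : EReal) ≤ ub ↔ (D.realX ν i j : EReal) ≤ a.val ν := by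
  classical
  by_cases h : ∃ i, (D.realX ν i j : EReal) ≤ ub
  · obtain ⟨i, hi⟩ := h
    obtain ⟨i₀, h₀, hmax⟩ := Finset.exists_max_image
      (Finset.univ.filter fun i => (D.realX ν i j : EReal) ≤ ub) (fun i => D.realX ν i j)
      ⟨i, by simpa using hi⟩
    simp only [Finset.mem_filter, Finset.mem_univ, true_and] at h₀ hmax
    exact ⟨_, num_mem_bounds D i₀ j, fun i =>
      ⟨fun h => EReal.coe_le_coe_iff.2 (hmax i h), fun h => h.trans h₀⟩⟩
  · push Not at h
    exact ⟨.negInf, by simp [Dataset.bounds], fun i => by simp [Bound.val, h i]⟩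

/-- Selected features have a range other than the full one. The converse may fail, but only this
inclusion is needed. -/
theorem cardinalityConstraint_descOf {D : Dataset} {ν : List Bool → ℝ} {p : List Range} {k : ℕ}
    (hn : p.length = D.n) (hp : p.countP restricts ≤ k) :
    CardinalityConstraint (D.realX ν) k ((descOf D.n p).lbVal ν) ((descOf D.n p).ubVal ν) := by
  refine le_trans ?_ hp
  have e : p = (List.finRange D.n).map fun j : Fin D.n => p.getD (j : ℕ) fullRange := by
    apply List.ext_getElem <;> simp [hn]
  conv_rhs => rw [e, List.countP_map, countP_finRange]
  refine Set.ncard_le_ncard (fun j hj => restricts_iff.2 fun hg => ?_)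
  obtain ⟨i, hi⟩ := hj
  have hg' : p.getD (j : ℕ) fullRange = fullRange := hg
  simp only [Desc.lbVal, Desc.ubVal, descOf, hg'] at hi
  simp [fullRange, Bound.val] at hi

/-- Bounds are moved to data values or ±∞ on selected features only. The others pass every
comparison, as they do with the full range, and thus consume no budget, so `k` suffices. -/
theorem exists_leaf (D : Dataset) (ν : List Bool → ℝ) {k : ℕ} {lb ub : Fin D.n → EReal}
    (h : CardinalityConstraint (D.realX ν) k lb ub) :
    ∃ p ∈ leaves (allRanges D.bounds) D.n k [], ∀ i j,
      (lb j ≤ (D.realX ν i j : EReal) ↔ (descOf D.n p).lbVal ν j ≤ (D.realX ν i j : EReal)) ∧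
      ((D.realX ν i j : EReal) ≤ ub j ↔ (D.realX ν i j : EReal) ≤ (descOf D.n p).ubVal ν j) := by
  classical
  choose a ha ha' using fun j => exists_lower_bound D ν j (lb j)
  choose b hb hb' using fun j => exists_upper_bound D ν j (ub j)
  let g : Fin D.n → Range := fun j =>
    if Selected (D.realX ν) lb ub j then (a j, b j) else fullRange
  let p : List Range := (List.finRange D.n).map g
  have hget : ∀ j : Fin D.n, p.getD (j : ℕ) fullRange = g j := by simp [p]
  refine ⟨p, ?_, fun i j => ?_⟩
  -- `mem_leaves` reverses its list, so it is applied to `p.reverse`.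
  · have hr : Ranges (allRanges D.bounds) p.reverse := by
      intro x hx
      obtain ⟨j, _, rfl⟩ := List.mem_map.1 (List.mem_reverse.1 hx)
      by_cases hs : Selected (D.realX ν) lb ub j
      · exact .inr (by simp only [g, if_pos hs]; exact mem_allRanges.2 ⟨ha j, hb j⟩)
      · exact .inl (by simp only [g, if_neg hs])
    have hc : p.reverse.countP restricts ≤ k := by
      rw [List.countP_reverse, List.countP_map, countP_finRange]
      refine le_trans (Set.ncard_le_ncard fun j hj => ?_) h
      by_contra hs
      have : g j = fullRange := if_neg hs
      exact restricts_iff.1 hj this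
    simpa [p] using mem_leaves hr hc []
  · simp only [Desc.lbVal, Desc.ubVal, descOf, hget]
    by_cases hs : Selected (D.realX ν) lb ub j
    · simp only [g, if_pos hs]
      exact ⟨ha' j i, hb' j i⟩
    · have hs' : lb j ≤ (D.realX ν i j : EReal) ∧ (D.realX ν i j : EReal) ≤ ub j := by
        constructor <;> by_contra hlt
        · exact hs ⟨i, .inl (not_le.1 hlt)⟩
        · exact hs ⟨i, .inr (not_le.1 hlt)⟩
      simp only [g, if_neg hs]
      simp [fullRange, Bound.val, hs'.1, hs'.2]

theorem isOptimalSubgroup_bestDesc {ν : List Bool → ℝ} {Q : Quality} (hQ : Q.DataDetermined)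
    {q : (D : Dataset) × Desc D.n → List Bool} {le : List Bool × List Bool → Bool}
    (hq : ∀ (D : Dataset) (s : Desc D.n),
      ν (q ⟨D, s⟩) = Q (s.lbVal ν) (s.ubVal ν) (D.realX ν) D.y)
    (hle : ∀ w, le w = true ↔ ν w.1 ≤ ν w.2) (D : Dataset) (k : ℕ) :
    IsOptimalSubgroup Q (D.realX ν) D.y k ((bestDesc q le D k).lbVal ν)
      ((bestDesc q le D k).ubVal ν) := by
  obtain ⟨h₁, -, h₃⟩ := foldl_better (qf := fun p => q ⟨D, descOf D.n p⟩)
    (le := fun w w' => le (w, w')) (v := fun p => ν (q ⟨D, descOf D.n p⟩))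
    (fun s p => hle _) (leaves (allRanges D.bounds) D.n k []) (List.replicate D.n fullRange)
  refine ⟨cardinalityConstraint_descOf (searchResult_ranges D k _ _).2 ?_, fun lb ub h => ?_⟩
  · rcases h₁ with h | h
    · rw [searchResult, h, List.countP_replicate]
      simp [restricts, fullRange]
    · exact (countP_le_of_mem_leaves h).trans (by simp)
  · obtain ⟨p, hp, hpq⟩ := exists_leaf D ν h
    show Q lb ub (D.realX ν) D.y ≤ Q _ _ (D.realX ν) D.y
    -- The arbitrary bounds have the same quality as the leaf `p`, which the running maximum
    -- dominates.
    rw [hQ _ _ _ D.y _ _ _ _ hpq, ← hq, ← hq]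
    exact h₃ p hp

theorem SearchInXP.mono {α αΓ βΓ : Type} {β : α → Type} {ea : α → List αΓ}
    {eb : ∀ x, β x → List βΓ} {κ : α → ℕ} {R R' : ∀ x, β x → Prop} (h : SearchInXP ea eb κ R)
    (hR : ∀ x o, R x o → R' x o) : SearchInXP ea eb κ R' := by
  obtain ⟨M, f, g, hf, hg, h⟩ := h
  refine ⟨M, f, g, hf, hg, fun x => ?_⟩
  obtain ⟨o, ho, ht⟩ := h x
  exact ⟨o, hR x o ho, ht⟩

end SubgroupDiscovery

/-! ### The search and decision problems -/

theorem mainTheorem11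
    (ν : List Bool → ℝ)
    (hν : SubgroupDiscovery.PolyTimeDecidable SubgroupDiscovery.encWords
      (fun p : List Bool × List Bool => ν p.1 ≤ ν p.2))
    (Q : SubgroupDiscovery.Quality)
    (hQ : SubgroupDiscovery.Quality.DataDetermined Q)
    (hQν : ∃ q : (D : SubgroupDiscovery.Dataset) × SubgroupDiscovery.Desc D.n → List Bool,
      SubgroupDiscovery.PolyTimeComputable SubgroupDiscovery.encDatasetDesc id q ∧
      ∀ (D : SubgroupDiscovery.Dataset) (s : SubgroupDiscovery.Desc D.n),
        ν (q ⟨D, s⟩) = Q (s.lbVal ν) (s.ubVal ν) (D.realX ν) D.y) :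
    SubgroupDiscovery.SearchInXP
      (β := fun x : SubgroupDiscovery.Dataset × ℕ => SubgroupDiscovery.Desc x.1.n)
      SubgroupDiscovery.encSearch (fun _ s => SubgroupDiscovery.encDesc s) (fun x => x.2)
      (fun x s => SubgroupDiscovery.IsOptimalSubgroup Q (x.1.realX ν) x.1.y x.2
        (s.lbVal ν) (s.ubVal ν)) ∧
    SubgroupDiscovery.DecisionInXP SubgroupDiscovery.encDecision (fun x => x.2.1)
      (fun x : SubgroupDiscovery.Dataset × ℕ × List Bool =>
        ∃ lb ub : Fin x.1.n → EReal,
          SubgroupDiscovery.CardinalityConstraint (x.1.realX ν) x.2.1 lb ub ∧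
          ν x.2.2 ≤ Q lb ub (x.1.realX ν) x.1.y) := by
  obtain ⟨le, hle, hle'⟩ := hν
  obtain ⟨q, hq', hq⟩ := hQν
  have hopt := SubgroupDiscovery.isOptimalSubgroup_bestDesc hQ hq hle
  constructor
  · refine (SubgroupDiscovery.bestDesc_searchInXP hq' hle').mono ?_
    rintro x s rfl
    exact hopt x.1 x.2
  · refine SubgroupDiscovery.SearchInXP.mono
      (SubgroupDiscovery.bestDesc_decisionInXP hq' hle') fun x o ho => ho.trans ?_
    obtain ⟨h₁, h₂⟩ := hopt x.1 x.2.1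
    refine (hle _).trans ?_
    show ν x.2.2 ≤ ν (q _) ↔ _
    rw [hq]
    -- The threshold is attained by some feasible bounds exactly if it is attained by the optimal
    -- ones.
    exact ⟨fun h => ⟨_, _, h₁, h⟩, fun ⟨lb, ub, hc, h⟩ => h.trans (h₂ lb ub hc)⟩
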